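/- Let $\nu\ge 1$, $\beta>0$, $\Delta>0$, $\lambda>0$, $\mu\in\mathbb R$. For $L>0$ let $\Lambda=[-L/2,L/2]^\nu$ with periodic boundary conditions, $V=L^\nu$, $\Lambda^*=\frac{2\pi}{L}\mathbb Z^\nu$, and let $a_k^\dagger,a_k$ $(k\in\Lambda^*)$ be the creation and annihilation operators on the boson Fock space $\mathcal F_B$ over the one-particle space of the box $\Lambda$. Put $N_\Lambda=\sum_{k\in\Lambda^*}a_k^\dagger a_k$ and, for $\delta\ge 0$, $$T^\delta_\Lambda=\sum_{k\in\Lambda^*}|k|^2a_k^\dagger a_k-\delta\,a_0^\dagger a_0,\qquad H^\delta_{\Lambda,\lambda}=T^\delta_\Lambda+\frac{\lambda}{2V}N_\Lambda^2 .$$ Then the thermodynamic limits $$p^\delta_\lambda(\beta,\mu)=\lim_{L\to\infty}\frac1{\beta V}\ln\operatorname{Tr}_{\mathcal F_B}e^{-\beta(H^\delta_{\Lambda,\lambda}-\mu N_\Lambda)}\qquad(\delta=\Delta\text{ and }\delta=0)$$ exist (with all traces finite), and so do the limits defining the pressure and the total density of the perfect Bose gas at chemical potential $-\Delta$, $$p^P(\beta,-\Delta)=\lim_{L\to\infty}\frac1{\beta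 V}\ln\operatorname{Tr}_{\mathcal F_B}e^{-\beta(T^0_\Lambda+\Delta N_\Lambda)},\qquad \rho^P(\beta,-\Delta)=\lim_{L\to\infty}\frac1V\,\frac{\operatorname{Tr}_{\mathcal F_B}\bigl(e^{-\beta(T^0_\Lambda+\Delta N_\Lambda)}N_\Lambda\bigr)}{\operatorname{Tr}_{\mathcal F_B}e^{-\beta(T^0_\Lambda+\Delta N_\Lambda)}},$$ and $$p^\Delta_\lambda(\beta,\mu)=\begin{cases}p^{0}_\lambda(\beta,\mu), & \mu\le-\Delta+\lambda\rho^P(\beta,-\Delta),\\[2pt] \dfrac{(\mu+\Delta)^2}{2\lambda}+p^P(\beta,-\Delta), & \mu>-\Delta+\lambda\rho^P(\beta,-\Delta).\end{cases}$$ -/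

import Mathlib

open Filter Topology

noncomputable section

namespace MeanFieldBose

/-- Labels `n ∈ ℤ^ν` of the one-particle modes (plane waves) of the periodic box `[-L/2, L/2]^ν`. -/
abbrev Mode (ν : ℕ) : Type := Fin ν → ℤ

/-- The momentum `k = 2πn/L` of the dual lattice `Λ*` that belongs to the label `n`. -/
def momentum (ν : ℕ) (L : ℝ) (n : Mode ν) : EuclideanSpace ℝ (Fin ν) :=
  WithLp.toLp 2 fun α => 2 * Real.pi * (n α : ℝ) / L

/-- The one-particle kinetic energy `ε_k = |k|²`, in units with `ħ²/2m = 1`. -/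
def kineticEnergy (ν : ℕ) (L : ℝ) (n : Mode ν) : ℝ := ‖momentum ν L n‖ ^ 2

/-- The volume `V = L^ν` of the box. -/
def boxVolume (ν : ℕ) (L : ℝ) : ℝ := L ^ ν

/-- Occupation numbers of the modes, finitely many of them different from zero. -/
abbrev Config (ν : ℕ) : Type := Mode ν →₀ ℕ

/-- The algebraic boson Fock space: finite linear combinations of occupation number states. -/
abbrev AlgFock (ν : ℕ) : Type := Config ν →₀ ℂ

/-- The boson Fock space `F_B` over the one-particle space spanned by the modes, in the occupation
number representation: the Hilbert space with orthonormal basis the occupation number states. -/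
abbrev Fock (ν : ℕ) : Type := lp (fun _ : Config ν => ℂ) 2

/-- The occupation number state `|n⟩`, as an element of the algebraic Fock space. -/
def ket {ν : ℕ} (n : Config ν) : AlgFock ν := Finsupp.single n 1

/-- The inclusion of the algebraic Fock space into the Fock space; its range is dense. -/
def toFock (ν : ℕ) : AlgFock ν →ₗ[ℂ] Fock ν :=
  Finsupp.linearCombination ℂ fun n : Config ν => (lp.single 2 n (1 : ℂ) : Fock ν)

/-- The linear operator on the algebraic Fock space with prescribed values on the states `|n⟩`. -/
def opOfKet {ν : ℕ} (f : Config ν → AlgFock ν) : Module.End ℂ (AlgFock ν) :=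
  Finsupp.linearCombination ℂ f

/-- The annihilation operator: `a_k |n⟩ = √(n_k) |n - δ_k⟩` (which is `0` if `n_k = 0`). -/
def annihilation {ν : ℕ} (k : Mode ν) : Module.End ℂ (AlgFock ν) :=
  opOfKet fun n => ((Real.sqrt (n k) : ℝ) : ℂ) • ket (n - Finsupp.single k 1)

/-- The creation operator: `a†_k |n⟩ = √(n_k + 1) |n + δ_k⟩`. -/
def creation {ν : ℕ} (k : Mode ν) : Module.End ℂ (AlgFock ν) :=
  opOfKet fun n => ((Real.sqrt (n k + 1) : ℝ) : ℂ) • ket (n + Finsupp.single k 1)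

/-- The number operator `N_k = a†_k a_k` of the mode `k`. -/
def modeNumber {ν : ℕ} (k : Mode ν) : Module.End ℂ (AlgFock ν) := creation k * annihilation k

/-- The operator `∑_k c_k a†_k a_k`; on each state `|n⟩` only the finitely many occupied modes
contribute to the sum. -/
def modeSum {ν : ℕ} (c : Mode ν → ℝ) : Module.End ℂ (AlgFock ν) :=
  opOfKet fun n => ∑ᶠ k : Mode ν, (c k : ℂ) • modeNumber k (ket n)

/-- The total number operator `N_Λ = ∑_k N_k`. -/
def totalNumber (ν : ℕ) : Module.End ℂ (AlgFock ν) := modeSum fun _ => 1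

/-- The kinetic energy with gap: `T^Δ_Λ = ∑_k ε_k a†_k a_k - Δ a†_0 a_0`. -/
def kinetic (ν : ℕ) (L Δ : ℝ) : Module.End ℂ (AlgFock ν) :=
  modeSum (kineticEnergy ν L) - (Δ : ℂ) • modeNumber (0 : Mode ν)

/-- The mean-field Hamiltonian `H^Δ_{Λ,λ} = T^Δ_Λ + (λ / 2V) N_Λ²`. -/
def meanFieldHamiltonian (ν : ℕ) (L Δ lam : ℝ) : Module.End ℂ (AlgFock ν) :=
  kinetic ν L Δ + ((lam / (2 * boxVolume ν L) : ℝ) : ℂ) • totalNumber ν ^ 2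

/-- The exponent `-β (H - μ N_Λ)`. -/
def gibbsExponent {ν : ℕ} (H : Module.End ℂ (AlgFock ν)) (β μ : ℝ) : Module.End ℂ (AlgFock ν) :=
  (-β : ℂ) • (H - (μ : ℂ) • totalNumber ν)

/-- `e^A ψ = ∑_j A^j ψ / j!`, the series converging in the norm of the Fock space. -/
def expOn {ν : ℕ} (A : Module.End ℂ (AlgFock ν)) (ψ : AlgFock ν) : Fock ν :=
  ∑' j : ℕ, ((Nat.factorial j : ℂ)⁻¹) • toFock ν ((A ^ j) ψ)

/-- The diagonal matrix element `⟨n| e^A B |n⟩`. -/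
def diagElement {ν : ℕ} (A B : Module.End ℂ (AlgFock ν)) (n : Config ν) : ℂ :=
  inner ℂ (toFock ν (ket n)) (expOn A (B (ket n)))

/-- The trace `Tr e^A B` over the Fock space, in the occupation number basis. -/
def traceExp {ν : ℕ} (A B : Module.End ℂ (AlgFock ν)) : ℂ := ∑' n : Config ν, diagElement A B n

/-- The exponential series of `A` defines a bounded positive operator on the Fock space, and this
operator has finite trace. -/
def IsTraceClassExp {ν : ℕ} (A : Module.End ℂ (AlgFock ν)) : Prop :=
  ∃ G : Fock ν →L[ℂ] Fock ν, G.IsPositive ∧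
    (∀ ψ : AlgFock ν,
      HasSum (fun j : ℕ => ((Nat.factorial j : ℂ)⁻¹) • toFock ν ((A ^ j) ψ)) (G (toFock ν ψ))) ∧
    Summable fun n : Config ν => inner ℂ (toFock ν (ket n)) (G (toFock ν (ket n)))

/-- The grand-canonical partition function `Tr e^{-β(H - μ N_Λ)}`. -/
def partitionFunction {ν : ℕ} (H : Module.End ℂ (AlgFock ν)) (β μ : ℝ) : ℝ :=
  (traceExp (gibbsExponent H β μ) 1).re

/-- The grand-canonical Gibbs expectation `Tr (e^{-β(H - μ N_Λ)} B) / Tr e^{-β(H - μ N_Λ)}`. -/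
def gibbsExpectation {ν : ℕ} (H : Module.End ℂ (AlgFock ν)) (β μ : ℝ)
    (B : Module.End ℂ (AlgFock ν)) : ℝ :=
  (traceExp (gibbsExponent H β μ) B).re / partitionFunction H β μ

/-- The grand-canonical pressure `(1 / βV) ln Tr e^{-β(H - μ N_Λ)}` in the box of side `L`. -/
def finitePressure (ν : ℕ) (L : ℝ) (H : Module.End ℂ (AlgFock ν)) (β μ : ℝ) : ℝ :=
  1 / (β * boxVolume ν L) * Real.log (partitionFunction H β μ)

/-- The pressure `p^Δ_{Λ,λ}(β, μ)` of the mean-field Bose gas with gap in the box of side `L`. -/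
def finiteMeanFieldPressure (ν : ℕ) (Δ lam β μ L : ℝ) : ℝ :=
  finitePressure ν L (meanFieldHamiltonian ν L Δ lam) β μ

/-- The pressure of the (gapless) perfect Bose gas in the box of side `L`. -/
def finitePerfectPressure (ν : ℕ) (β μ L : ℝ) : ℝ :=
  finitePressure ν L (kinetic ν L 0) β μ

/-- The total density `⟨N_Λ⟩ / V` of the (gapless) perfect Bose gas in the box of side `L`. -/
def finitePerfectDensity (ν : ℕ) (β μ L : ℝ) : ℝ :=
  gibbsExpectation (kinetic ν L 0) β μ (totalNumber ν) / boxVolume ν L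

/-- The thermodynamic limit `p^Δ_λ(β, μ)` of the mean-field pressure. -/
def meanFieldPressure (ν : ℕ) (Δ lam β μ : ℝ) : ℝ :=
  limUnder atTop (finiteMeanFieldPressure ν Δ lam β μ)

/-- The thermodynamic limit `p^P(β, μ)` of the perfect gas pressure. -/
def perfectPressure (ν : ℕ) (β μ : ℝ) : ℝ := limUnder atTop (finitePerfectPressure ν β μ)

/-- The thermodynamic limit `ρ^P(β, μ)` of the perfect gas density. -/
def perfectDensity (ν : ℕ) (β μ : ℝ) : ℝ := limUnder atTop (finitePerfectDensity ν β μ)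

end MeanFieldBose

end

/-!
The Hamiltonians are diagonal in the occupation numbers, so all traces are sums over
configurations `n` of the exponential of `-β(∑ ε_k n_k - δ n_0 + (λ / 2V) N² - μN)`, where `N` is
the number of particles (`traceExp_eq`). The pressure and the density of the perfect gas at chemical
potential `α < 0` are then sums over the modes of power series in the activities `e^{-β(ε_k - α)}`
(`Subcritical.hasSum_log`, `Subcritical.tsum_degree_weight`). Term by term these are heat traces of
the box, whose volume asymptotics follow from Poisson summation; by dominated convergence the
limits `p(α)` and `ρ(α)` exist (`tendsto_bulkSeries`) and are continuous in `α`.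

For the mean-field gas with gap `δ ≥ 0`, completing the square in `N` shows that
`U(α) = (μ - α)² / (2λ) + p(α)` is an asymptotic upper bound on the pressure for every `α < -δ`
(`finiteMeanFieldPressure_le`). For a lower bound, put `xV` particles into the mode `0` and apply
Jensen's inequality to the perfect gas of the other modes at `α`; the variance of its particle
number is of order `V`, so for `λ(x + ρ(α)) = μ - α` the resulting lower bound is
`U(α) + (α + δ) x` (`le_finiteMeanFieldPressure`).

If `λρ(α) = μ - α` for some `α < -δ`, then `x = 0`, the bounds agree, and the gap does not enter
(`tendsto_of_balance`). Otherwise `λρ(α) ≤ μ - α` for all `α < -δ`, and the bounds agree in the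
limit where `α` tends to `-δ`: the pressure converges (`exists_tendsto_of_deficit`), for a positive
gap to `U(-δ)` (`tendsto_of_deficit`). The second case occurs for the gap `Δ` whenever
`μ > -Δ + λρ(-Δ)`. If `μ ≤ -Δ + λρ(-Δ)`, there is either a balance below `-Δ`, which serves both
the gap `Δ` and the gap `0`, or one at `-Δ` itself, where `U(-Δ)` is the pressure of both systems.
-/

open Filter Topology

noncomputable section

namespace MeanFieldBose

/-! ### Independent bosonic modes -/

section Modes

variable {ι : Type*}

/-- The Gibbs weight `∏_k x_k ^ n_k` of the occupation numbers `n`, where `x_k` is the activity of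
the mode `k`. A mode is removed from the system by giving it the activity `0`, since `0 ^ 0 = 1`. -/
def weight (x : ι → ℝ) (n : ι →₀ ℕ) : ℝ := n.prod fun k m => x k ^ m

/-- The conditions on activities under which the gas of independent bosonic modes has a partition
function: they are summable, and bounded by some `r < 1`. -/
structure Subcritical (x : ι → ℝ) (r : ℝ) : Prop where
  nonneg : ∀ k, 0 ≤ x k
  le : ∀ k, x k ≤ r
  lt_one : r < 1
  summable : Summable x

/-- The partition function of independent bosonic modes with activities `x`. -/
def freePartition (x : ι → ℝ) : ℝ := ∑' n, weight x n

/-- The mean number of particles `∑_k x_k / (1 - x_k)` of independent bosonic modes. -/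
def meanNumber (x : ι → ℝ) : ℝ := ∑' k, x k / (1 - x k)

lemma weight_nonneg {x : ι → ℝ} (hx : ∀ k, 0 ≤ x k) (n : ι →₀ ℕ) : 0 ≤ weight x n :=
  Finset.prod_nonneg fun k _ => pow_nonneg (hx k) _

@[simp] lemma weight_zero (x : ι → ℝ) : weight x 0 = 1 := Finsupp.prod_zero_index

lemma weight_add (x : ι → ℝ) (m n : ι →₀ ℕ) : weight x (m + n) = weight x m * weight x n :=
  Finsupp.prod_add_index' (fun _ => pow_zero _) fun _ _ _ => pow_add _ _ _

lemma weight_single (x : ι → ℝ) (k : ι) (m : ℕ) : weight x (Finsupp.single k m) = x k ^ m :=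
  Finsupp.prod_single_index (pow_zero _)

lemma weight_const_mul (t : ℝ) (x : ι → ℝ) (n : ι →₀ ℕ) :
    weight (fun k => t * x k) n = t ^ n.degree * weight x n := by
  simp only [weight, Finsupp.prod, mul_pow, Finset.prod_mul_distrib, Finsupp.degree_apply,
    Finset.prod_pow_eq_pow_sum]

lemma Subcritical.mul_const {x : ι → ℝ} {r t : ℝ} (h : Subcritical x r) (ht : 0 ≤ t)
    (htr : t * r < 1) : Subcritical (fun k => t * x k) (t * r) where
  nonneg k := mul_nonneg ht (h.nonneg k)
  le k := mul_le_mul_of_nonneg_left (h.le k) ht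
  lt_one := htr
  summable := h.summable.mul_left t

/-- Finitely many configurations only occupy finitely many modes, each of them boundedly often, so
that their total weight is at most a finite product of geometric series. -/
lemma Subcritical.summable_weight {x : ι → ℝ} {r : ℝ} (h : Subcritical x r) :
    Summable (weight x) := by
  classical
  have hr : 0 < 1 - r := sub_pos.2 h.lt_one
  refine summable_of_sum_le (c := Real.exp (∑' k, x k / (1 - r))) (weight_nonneg h.nonneg)
    fun u => ?_
  set S : Finset ι := u.biUnion Finsupp.support
  set M : ℕ := u.sup Finsupp.degree
  have hsub : u ⊆ S.finsupp fun _ => Finset.range (M + 1) := fun n hn => by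
    refine Finset.mem_finsupp_iff.2 ⟨Finset.subset_biUnion_of_mem Finsupp.support hn, fun k _ => ?_⟩
    exact Finset.mem_range.2 (Nat.lt_succ_of_le
      ((Finsupp.le_degree k n).trans (Finset.le_sup (f := Finsupp.degree) hn)))
  have hgeom : ∀ k, ∑ j ∈ Finset.range (M + 1), x k ^ j ≤ Real.exp (x k / (1 - r)) := fun k => by
    have h1 : 0 < 1 - x k := by linarith [h.le k]
    calc ∑ j ∈ Finset.range (M + 1), x k ^ j
        ≤ ∑' j, x k ^ j := (summable_geometric_of_lt_one (h.nonneg k)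
          (by linarith)).sum_le_tsum _ fun j _ => pow_nonneg (h.nonneg k) j
      _ = (1 - x k)⁻¹ := tsum_geometric_of_lt_one (h.nonneg k) (by linarith)
      _ = x k / (1 - x k) + 1 := by field_simp; ring
      _ ≤ x k / (1 - r) + 1 := by
        gcongr
        · exact h.nonneg k
        · exact h.le k
      _ ≤ Real.exp (x k / (1 - r)) := Real.add_one_le_exp _
  calc ∑ n ∈ u, weight x n
      ≤ ∑ n ∈ S.finsupp fun _ => Finset.range (M + 1), weight x n :=
        Finset.sum_le_sum_of_subset_of_nonneg hsub fun n _ _ => weight_nonneg h.nonneg n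
    _ = ∏ k ∈ S, ∑ j ∈ Finset.range (M + 1), x k ^ j := by
        rw [Finset.prod_sum, Finset.finsupp, Finset.sum_map]
        refine Finset.sum_congr rfl fun p _ => ?_
        rw [Function.Embedding.coeFn_mk, weight,
          Finsupp.prod_of_support_subset _ (Finsupp.support_indicator_subset _ _) _
            (fun _ _ => pow_zero _), ← Finset.prod_attach]
        exact Finset.prod_congr rfl fun k _ => by rw [Finsupp.indicator_of_mem k.2]
    _ ≤ ∏ k ∈ S, Real.exp (x k / (1 - r)) :=
        Finset.prod_le_prod (fun k _ => Finset.sum_nonneg fun j _ => pow_nonneg (h.nonneg k) j)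
          fun k _ => hgeom k
    _ = Real.exp (∑ k ∈ S, x k / (1 - r)) := (Real.exp_sum _ _).symm
    _ ≤ Real.exp (∑' k, x k / (1 - r)) := Real.exp_le_exp.2
        ((h.summable.div_const _).sum_le_tsum _ fun k _ => div_nonneg (h.nonneg k) hr.le)

/-- A slight increase of all activities keeps them subcritical and absorbs any power of the particle
number, hence all moments of the particle number are finite. -/
lemma Subcritical.summable_degree_pow {x : ι → ℝ} {r : ℝ} (h : Subcritical x r) (p : ℕ) :
    Summable fun n : ι →₀ ℕ => (n.degree : ℝ) ^ p * weight x n := by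
  rcases isEmpty_or_nonempty ι with hι | ⟨⟨i⟩⟩
  · exact (hasSum_fintype _).summable
  have hr : 0 ≤ r := (h.nonneg i).trans (h.le i)
  have hlt := h.lt_one
  have ht : 1 < 2 / (1 + r) := by rw [lt_div_iff₀ (by linarith)]; linarith
  have htr : 2 / (1 + r) * r < 1 := by rw [div_mul_eq_mul_div, div_lt_one (by linarith)]; linarith
  set t : ℝ := 2 / (1 + r)
  have ht0 : 0 < t := by linarith
  obtain ⟨C, hC⟩ := (tendsto_pow_const_div_const_pow_of_one_lt p ht).bddAbove_range
  refine Summable.of_nonneg_of_le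
    (fun n => mul_nonneg (by positivity) (weight_nonneg h.nonneg n)) (fun n => ?_)
    ((h.mul_const ht0.le htr).summable_weight.mul_left C)
  have := hC ⟨n.degree, rfl⟩
  simp only [div_le_iff₀ (pow_pos ht0 _)] at this
  rw [weight_const_mul, ← mul_assoc]
  exact mul_le_mul_of_nonneg_right this (weight_nonneg h.nonneg n)

lemma Subcritical.one_le_freePartition {x : ι → ℝ} {r : ℝ} (h : Subcritical x r) :
    1 ≤ freePartition x := by
  simpa [freePartition] using h.summable_weight.le_tsum 0 fun n _ => weight_nonneg h.nonneg n

lemma Subcritical.freePartition_pos {x : ι → ℝ} {r : ℝ} (h : Subcritical x r) :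
    0 < freePartition x := zero_lt_one.trans_le h.one_le_freePartition

lemma mem_range_add_single {k : ι} {n : ι →₀ ℕ} (hn : n k ≠ 0) :
    n ∈ Set.range fun m : ι →₀ ℕ => m + Finsupp.single k 1 :=
  ⟨n - Finsupp.single k 1, tsub_add_cancel_of_le
    (Finsupp.single_le_iff.2 (Nat.one_le_iff_ne_zero.2 hn))⟩

/-- A sum over configurations in which the mode `k` is occupied, rewritten by removing one particle
from that mode. -/
lemma tsum_eq_tsum_add_single (k : ι) (f : (ι →₀ ℕ) → ℝ) (hf : ∀ n, n k = 0 → f n = 0) :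
    ∑' n, f n = ∑' n, f (n + Finsupp.single k 1) := by
  refine ((add_left_injective (Finsupp.single k 1)).tsum_eq fun n hn => ?_).symm
  exact mem_range_add_single fun h => hn (hf n h)

lemma Subcritical.ite_zero {x : ι → ℝ} {r : ℝ} (h : Subcritical x r) (p : ι → Prop)
    [DecidablePred p] : Subcritical (fun k => if p k then 0 else x k) r where
  nonneg k := by
    split_ifs
    · exact le_rfl
    · exact h.nonneg k
  le k := by
    split_ifs
    · exact (h.nonneg k).trans (h.le k)
    · exact h.le k
  lt_one := h.lt_one
  summable := h.summable.of_nonneg_of_le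
    (fun k => by split_ifs; exacts [le_rfl, h.nonneg k])
    (fun k => by split_ifs; exacts [h.nonneg k, le_rfl])

lemma weight_ite_zero (x : ι → ℝ) (p : ι → Prop) [DecidablePred p] (n : ι →₀ ℕ) :
    ((∀ k, p k → n k = 0) → weight (fun k => if p k then 0 else x k) n = weight x n) ∧
    (∀ k, p k → n k ≠ 0 → weight (fun k => if p k then 0 else x k) n = 0) := by
  constructor
  · intro hn
    refine Finset.prod_congr rfl fun k hk => ?_
    simp only [if_neg fun hp => Finsupp.mem_support_iff.1 hk (hn k hp)]
  · intro k hp hk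
    refine Finset.prod_eq_zero (Finsupp.mem_support_iff.2 hk) ?_
    simp [hp, hk]

/-- Removing the mode `k` divides the partition function by the geometric series
`1 / (1 - x_k)`. -/
lemma Subcritical.freePartition_remove [DecidableEq ι] {x : ι → ℝ} {r : ℝ} (h : Subcritical x r)
    (k : ι) :
    freePartition (fun l => if l = k then 0 else x l) = (1 - x k) * freePartition x := by
  have h0 := (h.ite_zero (· = k)).summable_weight
  have key := tsum_eq_tsum_add_single k
    (fun n => weight x n - weight (fun l => if l = k then 0 else x l) n) fun n hn => by
      rw [(weight_ite_zero x (· = k) n).1 fun l hl => hl ▸ hn, sub_self]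
  have hshift : ∀ n : ι →₀ ℕ, weight x (n + Finsupp.single k 1) -
      weight (fun l => if l = k then 0 else x l) (n + Finsupp.single k 1) = x k * weight x n :=
    fun n => by
      rw [(weight_ite_zero x (· = k) _).2 k rfl (by simp), weight_add, weight_single]
      ring
  simp only [hshift] at key
  rw [h.summable_weight.tsum_sub h0, tsum_mul_left] at key
  simp only [freePartition]
  linarith

/-- The logarithm of the partition function is the sum of the contributions `-log (1 - x_k)` of the
modes: when all modes of a growing finite set are removed, only the weight `1` of the vacuum
survives. -/
lemma Subcritical.hasSum_log {x : ι → ℝ} {r : ℝ} (h : Subcritical x r) :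
    HasSum (fun k => -Real.log (1 - x k)) (Real.log (freePartition x)) := by
  classical
  have hpos : ∀ k, 0 < 1 - x k := fun k => by linarith [h.le k, h.lt_one]
  have hprod : ∀ S : Finset ι, freePartition (fun k => if k ∈ S then 0 else x k) =
      (∏ k ∈ S, (1 - x k)) * freePartition x := fun S => by
    induction S using Finset.induction_on with
    | empty => simp
    | insert k S hk ih =>
      rw [Finset.prod_insert hk, mul_assoc, ← ih]
      have := (h.ite_zero (· ∈ S)).freePartition_remove k
      rw [if_neg hk] at this
      rw [← this]
      congr 1
      ext l
      by_cases hl : l = k <;> simp [hl]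
  have hlim : Tendsto (fun S : Finset ι => freePartition fun k => if k ∈ S then 0 else x k) atTop
      (𝓝 1) := by
    have : (1 : ℝ) = ∑' n : ι →₀ ℕ, if n = 0 then 1 else 0 := (tsum_ite_eq 0 fun _ => (1 : ℝ)).symm
    rw [this]
    refine tendsto_tsum_of_dominated_convergence h.summable_weight (fun n => ?_)
      (Eventually.of_forall fun S n => ?_)
    · split_ifs with hn
      · simp [hn]
      · obtain ⟨k, hk⟩ := Finsupp.ne_iff.1 hn
        refine tendsto_const_nhds.congr' ?_
        filter_upwards [eventually_ge_atTop {k}] with S hS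
        exact ((weight_ite_zero x (· ∈ S) n).2 k (hS (Finset.mem_singleton_self k)) hk).symm
    · rw [Real.norm_of_nonneg (weight_nonneg (h.ite_zero (· ∈ S)).nonneg n)]
      by_cases hS : ∀ k, k ∈ S → n k = 0
      · rw [(weight_ite_zero x (· ∈ S) n).1 hS]
      · push Not at hS
        obtain ⟨k, hk, hn⟩ := hS
        rw [(weight_ite_zero x (· ∈ S) n).2 k hk hn]
        exact weight_nonneg h.nonneg n
  have hlog := (hlim.log one_ne_zero).const_sub (Real.log (freePartition x))
  rw [Real.log_one, sub_zero] at hlog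
  refine hlog.congr fun S => ?_
  rw [hprod, Real.log_mul (Finset.prod_pos fun k _ => hpos k).ne' h.freePartition_pos.ne',
    Real.log_prod fun k _ => (hpos k).ne', Finset.sum_neg_distrib]
  ring

/-- The particle number is the sum of the occupation numbers, also under a sum over
configurations. -/
lemma hasSum_tsum_apply_mul {f : (ι →₀ ℕ) → ℝ} (hf : ∀ n, 0 ≤ f n)
    (hs : Summable fun n : ι →₀ ℕ => (n.degree : ℝ) * f n) :
    HasSum (fun k => ∑' n : ι →₀ ℕ, (n k : ℝ) * f n) (∑' n : ι →₀ ℕ, (n.degree : ℝ) * f n) := by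
  have hdeg : ∀ n : ι →₀ ℕ, HasSum (fun k => (n k : ℝ) * f n) ((n.degree : ℝ) * f n) := fun n => by
    have : (n.degree : ℝ) * f n = ∑ k ∈ n.support, (n k : ℝ) * f n := by
      rw [← Finset.sum_mul, Finsupp.degree_apply, Nat.cast_sum]
    rw [this]
    exact hasSum_sum_of_ne_finset_zero fun k hk => by simp [Finsupp.notMem_support_iff.1 hk]
  have hsum : Summable fun p : (ι →₀ ℕ) × ι => (p.1 p.2 : ℝ) * f p.1 :=
    (summable_prod_of_nonneg fun p => mul_nonneg (Nat.cast_nonneg _) (hf _)).2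
      ⟨fun n => (hdeg n).summable, hs.congr fun n => (hdeg n).tsum_eq.symm⟩
  have h1 : HasSum (fun p : (ι →₀ ℕ) × ι => (p.1 p.2 : ℝ) * f p.1)
      (∑' n : ι →₀ ℕ, (n.degree : ℝ) * f n) := by
    rw [hsum.hasSum_iff, hsum.tsum_prod]
    exact tsum_congr fun n => (hdeg n).tsum_eq
  have h2 := (Equiv.prodComm ι (ι →₀ ℕ)).hasSum_iff.2 h1
  exact h2.prod_fiberwise fun k => ((hsum.prod_symm).prod_factor k).hasSum

lemma summable_apply_mul {f : (ι →₀ ℕ) → ℝ} (hf : ∀ n, 0 ≤ f n)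
    (hs : Summable fun n : ι →₀ ℕ => (n.degree : ℝ) * f n) (k : ι) :
    Summable fun n : ι →₀ ℕ => (n k : ℝ) * f n :=
  hs.of_nonneg_of_le (fun n => mul_nonneg (Nat.cast_nonneg _) (hf n)) fun n =>
    mul_le_mul_of_nonneg_right (Nat.cast_le.2 (Finsupp.le_degree k n)) (hf n)

lemma Subcritical.tsum_apply_weight {x : ι → ℝ} {r : ℝ} (h : Subcritical x r) (k : ι) :
    ∑' n : ι →₀ ℕ, (n k : ℝ) * weight x n = freePartition x * (x k / (1 - x k)) := by
  have hk : 0 < 1 - x k := by linarith [h.le k, h.lt_one]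
  have hs := summable_apply_mul (weight_nonneg h.nonneg) (by simpa using h.summable_degree_pow 1) k
  have key := tsum_eq_tsum_add_single k (fun n => (n k : ℝ) * weight x n) fun n hn => by simp [hn]
  have hshift : ∀ n : ι →₀ ℕ, ((n + Finsupp.single k 1 : ι →₀ ℕ) k : ℝ) *
      weight x (n + Finsupp.single k 1) = x k * ((n k : ℝ) * weight x n + weight x n) := fun n => by
    rw [weight_add, weight_single]
    simp
    ring
  simp only [hshift] at key
  rw [tsum_mul_left, hs.tsum_add h.summable_weight] at key
  rw [mul_div_assoc', eq_div_iff hk.ne', freePartition]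
  linarith

lemma Subcritical.hasSum_meanNumber {x : ι → ℝ} {r : ℝ} (h : Subcritical x r) :
    HasSum (fun k => x k / (1 - x k)) (meanNumber x) := by
  have hr : 0 < 1 - r := sub_pos.2 h.lt_one
  refine (Summable.of_nonneg_of_le (fun k => ?_) (fun k => ?_)
    (h.summable.div_const (1 - r))).hasSum
  · exact div_nonneg (h.nonneg k) (by linarith [h.le k])
  · gcongr
    · exact h.nonneg k
    · exact h.le k

lemma Subcritical.tsum_degree_weight {x : ι → ℝ} {r : ℝ} (h : Subcritical x r) :
    ∑' n : ι →₀ ℕ, (n.degree : ℝ) * weight x n = freePartition x * meanNumber x := by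
  have hs := hasSum_tsum_apply_mul (weight_nonneg h.nonneg) (by simpa using h.summable_degree_pow 1)
  simp only [h.tsum_apply_weight] at hs
  exact hs.unique (h.hasSum_meanNumber.mul_left _)

/-- The variance of the particle number is at most its mean times `1 / (1 - r)`. -/
lemma Subcritical.tsum_degree_sq_weight_le {x : ι → ℝ} {r : ℝ} (h : Subcritical x r) :
    ∑' n : ι →₀ ℕ, (n.degree : ℝ) ^ 2 * weight x n ≤
      freePartition x * (meanNumber x ^ 2 + meanNumber x / (1 - r)) := by
  have hs1 : Summable fun n : ι →₀ ℕ => (n.degree : ℝ) * weight x n := by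
    simpa using h.summable_degree_pow 1
  have hs2 : Summable fun n : ι →₀ ℕ => (n.degree : ℝ) * ((n.degree : ℝ) * weight x n) :=
    (h.summable_degree_pow 2).congr fun n => by ring
  have hf : ∀ n : ι →₀ ℕ, 0 ≤ (n.degree : ℝ) * weight x n := fun n =>
    mul_nonneg (Nat.cast_nonneg _) (weight_nonneg h.nonneg n)
  have hmode : ∀ k, ∑' n : ι →₀ ℕ, (n k : ℝ) * ((n.degree : ℝ) * weight x n) ≤
      freePartition x * (meanNumber x + 1 / (1 - r)) * (x k / (1 - x k)) := fun k => by
    have hk : 0 < 1 - x k := by linarith [h.le k, h.lt_one]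
    have hkd := summable_apply_mul hf hs2 k
    have hk1 := summable_apply_mul (weight_nonneg h.nonneg) hs1 k
    have key := tsum_eq_tsum_add_single k (fun n => (n k : ℝ) * ((n.degree : ℝ) * weight x n))
      fun n hn => by simp [hn]
    have hshift : ∀ n : ι →₀ ℕ, ((n + Finsupp.single k 1 : ι →₀ ℕ) k : ℝ) *
        (((n + Finsupp.single k 1 : ι →₀ ℕ).degree : ℝ) * weight x (n + Finsupp.single k 1)) =
        x k * (((n k : ℝ) * ((n.degree : ℝ) * weight x n) + (n k : ℝ) * weight x n) +
          ((n.degree : ℝ) * weight x n + weight x n)) := fun n => by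
      rw [weight_add, weight_single, map_add, Finsupp.degree_single]
      simp
      ring
    simp only [hshift] at key
    rw [tsum_mul_left, (hkd.add hk1).tsum_add (hs1.add h.summable_weight), hkd.tsum_add hk1,
      hs1.tsum_add h.summable_weight, h.tsum_apply_weight, h.tsum_degree_weight,
      ← freePartition] at key
    have hval : ∑' n : ι →₀ ℕ, (n k : ℝ) * ((n.degree : ℝ) * weight x n) =
        freePartition x * (meanNumber x + 1 / (1 - x k)) * (x k / (1 - x k)) := by
      rw [mul_div_assoc', eq_div_iff hk.ne']
      have : 1 / (1 - x k) = x k / (1 - x k) + 1 := by field_simp; ring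
      rw [this]
      linarith
    rw [hval]
    have := h.freePartition_pos.le
    have := h.le k
    have := sub_pos.2 h.lt_one
    have := div_nonneg (h.nonneg k) hk.le
    gcongr
  have hs := hasSum_tsum_apply_mul hf hs2
  calc ∑' n : ι →₀ ℕ, (n.degree : ℝ) ^ 2 * weight x n
      = ∑' n : ι →₀ ℕ, (n.degree : ℝ) * ((n.degree : ℝ) * weight x n) :=
        tsum_congr fun n => by ring
    _ ≤ freePartition x * (meanNumber x + 1 / (1 - r)) * meanNumber x :=
        hasSum_le hmode hs (h.hasSum_meanNumber.mul_left _)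
    _ = _ := by ring

/-- Jensen's inequality for the exponential function and the probability weights `w / ∑ w`. -/
lemma tsum_mul_exp_mean_le {α : Type*} {w g f : α → ℝ} (hw : ∀ n, 0 ≤ w n) (hsw : Summable w)
    (hpos : 0 < ∑' n, w n) (hsg : Summable fun n => w n * g n) (hsf : Summable f)
    (hf : ∀ n, w n * Real.exp (g n) ≤ f n) :
    (∑' n, w n) * Real.exp ((∑' n, w n * g n) / ∑' n, w n) ≤ ∑' n, f n := by
  set c : ℝ := (∑' n, w n * g n) / ∑' n, w n with hc
  -- the tangent to the exponential function at the mean value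
  have hle : ∀ n, Real.exp c * (w n * g n + (1 - c) * w n) ≤ f n := fun n => by
    refine le_trans ?_ (hf n)
    have h1 : Real.exp (g n) = Real.exp c * Real.exp (g n - c) := by rw [← Real.exp_add]; ring_nf
    have h2 := Real.add_one_le_exp (g n - c)
    have h3 := mul_le_mul_of_nonneg_left h2 (mul_nonneg (hw n) (Real.exp_nonneg c))
    rw [h1]
    linarith
  have hs := hsg.add (hsw.mul_left (1 - c))
  refine le_trans (le_of_eq ?_) ((hs.mul_left (Real.exp c)).tsum_le_tsum hle hsf)
  rw [tsum_mul_left, hsg.tsum_add (hsw.mul_left _), tsum_mul_left]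
  have : ∑' n, w n * g n = c * ∑' n, w n := by rw [hc, div_mul_cancel₀ _ hpos.ne']
  rw [this]
  ring

end Modes

/-! ### The perfect gas in the thermodynamic limit -/

section Perfect

lemma summable_exp_neg_mul_int_sq {a : ℝ} (ha : 0 < a) :
    Summable fun m : ℤ => Real.exp (-a * (m : ℝ) ^ 2) := by
  refine (summable_pow_mul_jacobiTheta₂_term_bound 0 (div_pos ha Real.pi_pos) 0).congr fun m => ?_
  simp only [pow_zero, one_mul, mul_zero, zero_mul, sub_zero]
  congr 1
  field_simp

lemma tendsto_tsum_exp_neg_mul_int_sq {c : ℝ} (hc : 0 < c) :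
    Tendsto (fun L : ℝ => ∑' m : ℤ, Real.exp (-(c * L ^ 2) * (m : ℝ) ^ 2)) atTop (𝓝 1) := by
  have h1 : (1 : ℝ) = ∑' m : ℤ, if m = 0 then 1 else 0 :=
    (tsum_ite_eq 0 fun _ => (1 : ℝ)).symm
  rw [h1]
  refine tendsto_tsum_of_dominated_convergence (summable_exp_neg_mul_int_sq hc) (fun m => ?_) ?_
  · split_ifs with hm
    · simp [hm]
    · have hm' : 0 < c * (m : ℝ) ^ 2 := by positivity
      refine Real.tendsto_exp_atBot.comp ?_
      have := ((tendsto_pow_atTop (two_ne_zero (α := ℕ))).const_mul_atTop hm' : Tendsto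
        (fun L : ℝ => c * (m : ℝ) ^ 2 * L ^ 2) atTop atTop)
      exact (tendsto_neg_atTop_atBot.comp this).congr fun L => by simp; ring
  · filter_upwards [eventually_ge_atTop 1] with L hL m
    rw [Real.norm_of_nonneg (Real.exp_nonneg _), Real.exp_le_exp]
    have : c ≤ c * L ^ 2 := le_mul_of_one_le_right hc.le (one_le_pow₀ hL)
    nlinarith [sq_nonneg (m : ℝ)]

/-- The Riemann sums of a Gaussian converge to its integral. Poisson summation turns the mesh
`1 / L` into a dual Gaussian sum of which only the central term survives. -/
lemma tendsto_gaussian_riemann_sum {b : ℝ} (hb : 0 < b) :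
    Tendsto (fun L : ℝ => (∑' m : ℤ, Real.exp (-(b / L ^ 2) * (m : ℝ) ^ 2)) / L) atTop
      (𝓝 (√(Real.pi / b))) := by
  have hπ := Real.pi_pos
  have h := (tendsto_tsum_exp_neg_mul_int_sq (c := Real.pi ^ 2 / b) (by positivity)).const_mul
    (√(Real.pi / b))
  rw [mul_one] at h
  refine h.congr' ?_
  filter_upwards [eventually_gt_atTop 0] with L hL
  have ha : 0 < b / (Real.pi * L ^ 2) := by positivity
  have key := Real.tsum_exp_neg_mul_int_sq ha
  have e1 : ∀ m : ℤ, -(b / L ^ 2) * (m : ℝ) ^ 2 =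
      -Real.pi * (b / (Real.pi * L ^ 2)) * (m : ℝ) ^ 2 := fun m => by field_simp
  have e2 : ∀ m : ℤ, -(Real.pi ^ 2 / b * L ^ 2) * (m : ℝ) ^ 2 =
      -Real.pi / (b / (Real.pi * L ^ 2)) * (m : ℝ) ^ 2 := fun m => by field_simp
  have e3 : √(Real.pi / b) = 1 / √(b / (Real.pi * L ^ 2)) / L := by
    rw [← div_div b, Real.sqrt_div' _ (sq_nonneg L), Real.sqrt_sq hL.le, ← inv_div b,
      Real.sqrt_inv]
    field_simp
  simp only [e1, e2, key, ← Real.sqrt_eq_rpow, e3]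
  ring

lemma hasSum_pi_prod {f : ℤ → ℝ} (hf : ∀ m, 0 ≤ f m) (hs : Summable f) (ν : ℕ) :
    HasSum (fun n : Fin ν → ℤ => ∏ i, f (n i)) ((∑' m, f m) ^ ν) := by
  induction ν with
  | zero => simp
  | succ ν ih =>
    rw [← (Fin.consEquiv fun _ => ℤ).hasSum_iff, pow_succ']
    have hprod : Summable fun p : ℤ × (Fin ν → ℤ) => f p.1 * ∏ i, f (p.2 i) :=
      Summable.mul_of_nonneg (g := fun n : Fin ν → ℤ => ∏ i, f (n i)) hs ih.summable hf
        fun n => Finset.prod_nonneg fun i _ => hf (n i)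
    have hmul := HasSum.mul (g := fun n : Fin ν → ℤ => ∏ i, f (n i)) hs.hasSum ih hprod
    have heq : ((fun n : Fin (ν + 1) → ℤ => ∏ i, f (n i)) ∘ Fin.consEquiv fun _ => ℤ) =
        fun p : ℤ × (Fin ν → ℤ) => f p.1 * ∏ i, f (p.2 i) := by
      funext p
      simp [Fin.prod_univ_succ, Fin.consEquiv]
    rw [heq]
    exact hmul

variable {ν : ℕ}

lemma kineticEnergy_eq (L : ℝ) (n : Mode ν) :
    kineticEnergy ν L n = ∑ i, (2 * Real.pi / L) ^ 2 * (n i : ℝ) ^ 2 := by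
  rw [kineticEnergy, EuclideanSpace.real_norm_sq_eq]
  refine Finset.sum_congr rfl fun i _ => ?_
  simp only [momentum]
  ring

lemma kineticEnergy_nonneg (L : ℝ) (n : Mode ν) : 0 ≤ kineticEnergy ν L n := sq_nonneg _

@[simp] lemma kineticEnergy_zero (L : ℝ) : kineticEnergy ν L 0 = 0 := by
  simp [kineticEnergy_eq]

lemma boxVolume_pos {L : ℝ} (hL : 0 < L) : 0 < boxVolume ν L := pow_pos hL ν

lemma tendsto_boxVolume (hν : 1 ≤ ν) : Tendsto (boxVolume ν) atTop atTop :=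
  tendsto_pow_atTop (by omega)

/-- The heat trace `∑_k e^{-t ε_k}` of the box. -/
def heatTrace (ν : ℕ) (L t : ℝ) : ℝ := ∑' k : Mode ν, Real.exp (-(t * kineticEnergy ν L k))

/-- The heat trace per unit volume of infinite space, `(4πt)^{-ν/2}`. -/
def heatDensity (ν : ℕ) (t : ℝ) : ℝ := √(Real.pi / (t * (2 * Real.pi) ^ 2)) ^ ν

lemma hasSum_heatTrace {L t : ℝ} (hL : 0 < L) (ht : 0 < t) :
    HasSum (fun k : Mode ν => Real.exp (-(t * kineticEnergy ν L k)))
      ((∑' m : ℤ, Real.exp (-(t * (2 * Real.pi) ^ 2 / L ^ 2) * (m : ℝ) ^ 2)) ^ ν) := by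
  have hπ := Real.pi_pos
  have ha : 0 < t * (2 * Real.pi) ^ 2 / L ^ 2 := by positivity
  convert hasSum_pi_prod (f := fun m : ℤ => Real.exp (-(t * (2 * Real.pi) ^ 2 / L ^ 2) * m ^ 2))
    (fun m => Real.exp_nonneg _) (summable_exp_neg_mul_int_sq ha) ν using 1
  funext k
  rw [← Real.exp_sum, kineticEnergy_eq, Finset.mul_sum, ← Finset.sum_neg_distrib]
  congr 1
  refine Finset.sum_congr rfl fun i _ => ?_
  ring

lemma tendsto_heatTrace {t : ℝ} (ht : 0 < t) :
    Tendsto (fun L => heatTrace ν L t / boxVolume ν L) atTop (𝓝 (heatDensity ν t)) := by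
  have hπ := Real.pi_pos
  refine ((tendsto_gaussian_riemann_sum (b := t * (2 * Real.pi) ^ 2) (by positivity)).pow
    ν).congr' ?_
  filter_upwards [eventually_gt_atTop 0] with L hL
  rw [heatTrace, (hasSum_heatTrace hL ht).tsum_eq, boxVolume, div_pow]

lemma heatTrace_nonneg (L t : ℝ) : 0 ≤ heatTrace ν L t := tsum_nonneg fun _ => Real.exp_nonneg _

lemma heatTrace_antitone {L s t : ℝ} (hL : 0 < L) (hs : 0 < s) (hst : s ≤ t) :
    heatTrace ν L t ≤ heatTrace ν L s := by
  refine (hasSum_heatTrace hL (hs.trans_le hst)).summable.tsum_le_tsum (fun k => ?_)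
    (hasSum_heatTrace hL hs).summable
  rw [Real.exp_le_exp, neg_le_neg_iff]
  exact mul_le_mul_of_nonneg_right hst (kineticEnergy_nonneg L k)

lemma heatDensity_nonneg (t : ℝ) : 0 ≤ heatDensity ν t := pow_nonneg (Real.sqrt_nonneg _) ν

lemma heatDensity_antitone {s t : ℝ} (hs : 0 < s) (hst : s ≤ t) :
    heatDensity ν t ≤ heatDensity ν s := by
  have hπ := Real.pi_pos
  unfold heatDensity
  gcongr

/-- The activity `e^{-β(ε_k - α)}` of the mode `k` of the perfect gas at chemical potential `α`. -/
def activity (ν : ℕ) (β L α : ℝ) (k : Mode ν) : ℝ := Real.exp (-(β * (kineticEnergy ν L k - α)))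

lemma activity_pow (β L α : ℝ) (k : Mode ν) (j : ℕ) :
    activity ν β L α k ^ (j + 1) =
      Real.exp (β * α) ^ (j + 1) * Real.exp (-((β * (j + 1)) * kineticEnergy ν L k)) := by
  rw [activity, ← Real.exp_nat_mul, ← Real.exp_nat_mul, ← Real.exp_add]
  congr 1
  push_cast
  ring

lemma subcritical_activity {β L α : ℝ} (hβ : 0 < β) (hL : 0 < L) (hα : α < 0) :
    Subcritical (activity ν β L α) (Real.exp (β * α)) where
  nonneg k := Real.exp_nonneg _
  le k := Real.exp_le_exp.2 (by nlinarith [kineticEnergy_nonneg L k])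
  lt_one := Real.exp_lt_one_iff.2 (mul_neg_of_pos_of_neg hβ hα)
  summable := by
    refine ((hasSum_heatTrace (ν := ν) hL hβ).summable.mul_left (Real.exp (β * α))).congr
      fun k => ?_
    simpa using (activity_pow β L α k 0).symm

/-- A power series in the activity `e^{βα}`, with coefficients `c_j` times the heat traces
of infinite space: the limit per unit volume of a sum over all modes of the power series `c` in
their activities. -/
def bulkSeries (ν : ℕ) (β : ℝ) (c : ℕ → ℝ) (α : ℝ) : ℝ :=
  ∑' j : ℕ, c j * (Real.exp (β * α) ^ (j + 1) * heatDensity ν (β * (j + 1)))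

lemma summable_exp_pow_mul {β α : ℝ} (hβ : 0 < β) (hα : α < 0) (K : ℝ) :
    Summable fun j : ℕ => Real.exp (β * α) ^ (j + 1) * K :=
  ((summable_nat_add_iff 1).2 (summable_geometric_of_lt_one (Real.exp_nonneg _)
    (Real.exp_lt_one_iff.2 (mul_neg_of_pos_of_neg hβ hα)))).mul_right K

lemma le_mul_natCast_add_one {β : ℝ} (hβ : 0 < β) (j : ℕ) : β ≤ β * ((j : ℝ) + 1) :=
  le_mul_of_one_le_right hβ.le (by linarith [(Nat.cast_nonneg j : (0 : ℝ) ≤ j)])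

lemma bulkSeries_term_le {β : ℝ} (hβ : 0 < β) {c : ℕ → ℝ} (hc : ∀ j, 0 ≤ c j ∧ c j ≤ 1)
    {α α' : ℝ} (h : α ≤ α') (j : ℕ) :
    c j * (Real.exp (β * α) ^ (j + 1) * heatDensity ν (β * (j + 1))) ≤
      Real.exp (β * α') ^ (j + 1) * heatDensity ν β := by
  have h1 := heatDensity_nonneg (ν := ν) (β * (j + 1))
  refine (mul_le_of_le_one_left (by positivity) (hc j).2).trans ?_
  have := heatDensity_antitone (ν := ν) hβ (le_mul_natCast_add_one hβ j)
  gcongr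

lemma bulkSeries_term_nonneg (β : ℝ) {c : ℕ → ℝ} (hc : ∀ j, 0 ≤ c j ∧ c j ≤ 1) (α : ℝ) (j : ℕ) :
    0 ≤ c j * (Real.exp (β * α) ^ (j + 1) * heatDensity ν (β * (j + 1))) := by
  have h1 := heatDensity_nonneg (ν := ν) (β * (j + 1))
  have := (hc j).1
  positivity

lemma summable_bulkSeries {β : ℝ} (hβ : 0 < β) {c : ℕ → ℝ} (hc : ∀ j, 0 ≤ c j ∧ c j ≤ 1)
    {α : ℝ} (hα : α < 0) :
    Summable fun j : ℕ => c j * (Real.exp (β * α) ^ (j + 1) * heatDensity ν (β * (j + 1))) :=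
  (summable_exp_pow_mul hβ hα (heatDensity ν β)).of_nonneg_of_le (bulkSeries_term_nonneg β hc α)
    fun j => bulkSeries_term_le hβ hc le_rfl j

lemma bulkSeries_nonneg (β : ℝ) {c : ℕ → ℝ} (hc : ∀ j, 0 ≤ c j ∧ c j ≤ 1) (α : ℝ) :
    0 ≤ bulkSeries ν β c α := tsum_nonneg (bulkSeries_term_nonneg β hc α)

lemma bulkSeries_mono {β : ℝ} (hβ : 0 < β) {c : ℕ → ℝ} (hc : ∀ j, 0 ≤ c j ∧ c j ≤ 1)
    {α α' : ℝ} (h : α ≤ α') (hα' : α' < 0) : bulkSeries ν β c α ≤ bulkSeries ν β c α' := by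
  refine (summable_bulkSeries hβ hc (h.trans_lt hα')).tsum_le_tsum (fun j => ?_)
    (summable_bulkSeries hβ hc hα')
  have h1 := heatDensity_nonneg (ν := ν) (β * (j + 1))
  have := (hc j).1
  gcongr

lemma continuousOn_bulkSeries {β : ℝ} (hβ : 0 < β) {c : ℕ → ℝ} (hc : ∀ j, 0 ≤ c j ∧ c j ≤ 1) :
    ContinuousOn (bulkSeries ν β c) (Set.Iio 0) := by
  intro α hα
  obtain ⟨α', h1, h2⟩ := exists_between (Set.mem_Iio.1 hα)
  refine ContinuousAt.continuousWithinAt (ContinuousOn.continuousAt (s := Set.Iic α') ?_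
    (Iic_mem_nhds h1))
  refine continuousOn_tsum (fun j => by fun_prop)
    (summable_exp_pow_mul hβ h2 (heatDensity ν β)) fun j a ha => ?_
  rw [Real.norm_of_nonneg (bulkSeries_term_nonneg β hc a j)]
  exact bulkSeries_term_le hβ hc ha j

lemma tsum_tsum_activity {β : ℝ} (hβ : 0 < β) {c : ℕ → ℝ} (hc : ∀ j, 0 ≤ c j ∧ c j ≤ 1)
    {α L : ℝ} (hα : α < 0) (hL : 0 < L) :
    ∑' k : Mode ν, ∑' j : ℕ, c j * activity ν β L α k ^ (j + 1) =
      ∑' j : ℕ, c j * (Real.exp (β * α) ^ (j + 1) * heatTrace ν L (β * (j + 1))) := by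
  have hsum : Summable fun p : Mode ν × ℕ => c p.2 * activity ν β L α p.1 ^ (p.2 + 1) := by
    have hbound : Summable fun p : Mode ν × ℕ =>
        Real.exp (-(β * kineticEnergy ν L p.1)) * (Real.exp (β * α) ^ (p.2 + 1) * 1) :=
      Summable.mul_of_nonneg (f := fun k : Mode ν => Real.exp (-(β * kineticEnergy ν L k)))
        (g := fun j : ℕ => Real.exp (β * α) ^ (j + 1) * 1)
        (hasSum_heatTrace hL hβ).summable (summable_exp_pow_mul hβ hα 1)
        (fun k => Real.exp_nonneg _) fun j => mul_nonneg (pow_nonneg (Real.exp_nonneg _) _)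
          zero_le_one
    have h0 := (subcritical_activity (ν := ν) hβ hL hα).nonneg
    refine hbound.of_nonneg_of_le (fun p => mul_nonneg (hc _).1 (pow_nonneg (h0 _) _))
      fun p => ?_
    refine (mul_le_of_le_one_left (pow_nonneg (h0 _) _) (hc _).2).trans ?_
    rw [activity_pow, mul_one, mul_comm (Real.exp (-(β * kineticEnergy ν L p.1)))]
    have := mul_le_mul_of_nonneg_right (le_mul_natCast_add_one hβ p.2)
      (kineticEnergy_nonneg L p.1)
    gcongr
  have hcomm := Summable.tsum_comm (f := fun (k : Mode ν) (j : ℕ) =>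
    c j * activity ν β L α k ^ (j + 1)) hsum
  rw [← hcomm]
  refine tsum_congr fun j => ?_
  simp only [activity_pow, tsum_mul_left, heatTrace]

/-- Thermodynamic limit of a sum over all modes of a power series in their activities. -/
lemma tendsto_bulkSeries {β : ℝ} (hβ : 0 < β) {c : ℕ → ℝ} (hc : ∀ j, 0 ≤ c j ∧ c j ≤ 1)
    {α : ℝ} (hα : α < 0) :
    Tendsto (fun L => (∑' k : Mode ν, ∑' j : ℕ, c j * activity ν β L α k ^ (j + 1)) /
      boxVolume ν L) atTop (𝓝 (bulkSeries ν β c α)) := by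
  have hlim : Tendsto (fun L => ∑' j : ℕ, c j * (Real.exp (β * α) ^ (j + 1) *
      (heatTrace ν L (β * (j + 1)) / boxVolume ν L))) atTop (𝓝 (bulkSeries ν β c α)) := by
    refine tendsto_tsum_of_dominated_convergence
      (summable_exp_pow_mul hβ hα (heatDensity ν β + 1))
      (fun j => ((tendsto_heatTrace (by positivity)).const_mul _).const_mul _) ?_
    filter_upwards [eventually_gt_atTop 0, (tendsto_heatTrace (ν := ν) hβ).eventually_le_const
      (lt_add_one (heatDensity ν β))] with L hL hK j
    have hV := boxVolume_pos (ν := ν) hL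
    have h1 := heatTrace_nonneg (ν := ν) L (β * (j + 1))
    have h2 := (hc j).1
    rw [Real.norm_of_nonneg (by positivity)]
    refine (mul_le_of_le_one_left (by positivity) (hc j).2).trans ?_
    have h3 := heatTrace_antitone (ν := ν) hL hβ (le_mul_natCast_add_one hβ j)
    refine mul_le_mul_of_nonneg_left (le_trans ?_ hK) (by positivity)
    gcongr
  refine hlim.congr' ?_
  filter_upwards [eventually_gt_atTop 0] with L hL
  rw [tsum_tsum_activity hβ hc hα hL, ← tsum_div_const]
  refine tsum_congr fun j => ?_
  ring

/-- The density `∑_j e^{jβα} (4πβj)^{-ν/2}` of the perfect gas in infinite volume. -/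
def bulkDensity (ν : ℕ) (β α : ℝ) : ℝ := bulkSeries ν β (fun _ => 1) α

/-- The pressure `β⁻¹ ∑_j e^{jβα} (4πβj)^{-ν/2} / j` of the perfect gas in infinite volume. -/
def bulkPressure (ν : ℕ) (β α : ℝ) : ℝ := bulkSeries ν β (fun j => 1 / (j + 1)) α / β

lemma tendsto_meanNumber_activity {β α : ℝ} (hβ : 0 < β) (hα : α < 0) :
    Tendsto (fun L => meanNumber (activity ν β L α) / boxVolume ν L) atTop
      (𝓝 (bulkDensity ν β α)) := by
  refine (tendsto_bulkSeries hβ (fun _ => ⟨zero_le_one, le_rfl⟩) hα).congr' ?_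
  filter_upwards [eventually_gt_atTop 0] with L hL
  have h := subcritical_activity (ν := ν) hβ hL hα
  congr 1
  refine tsum_congr fun k => ?_
  simp only [one_mul, pow_succ']
  rw [tsum_mul_left, tsum_geometric_of_lt_one (h.nonneg k) ((h.le k).trans_lt h.lt_one),
    div_eq_mul_inv]

lemma tendsto_log_freePartition_activity {β α : ℝ} (hβ : 0 < β) (hα : α < 0) :
    Tendsto (fun L => Real.log (freePartition (activity ν β L α)) / (β * boxVolume ν L)) atTop
      (𝓝 (bulkPressure ν β α)) := by
  refine ((tendsto_bulkSeries hβ (c := fun j => 1 / (j + 1)) (fun j => ⟨by positivity, ?_⟩)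
    hα).div_const β).congr' ?_
  · exact div_le_one_of_le₀ (by linarith [(Nat.cast_nonneg j : (0 : ℝ) ≤ j)]) (by positivity)
  filter_upwards [eventually_gt_atTop 0] with L hL
  have h := subcritical_activity (ν := ν) hβ hL hα
  rw [← h.hasSum_log.tsum_eq, div_div, mul_comm β]
  congr 1
  refine tsum_congr fun k => ?_
  rw [← (Real.hasSum_pow_div_log_of_abs_lt_one (x := activity ν β L α k) ?_).tsum_eq]
  · exact tsum_congr fun j => by ring
  · rw [abs_of_nonneg (h.nonneg k)]
    exact (h.le k).trans_lt h.lt_one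

lemma bulkDensity_nonneg (β α : ℝ) : 0 ≤ bulkDensity ν β α :=
  bulkSeries_nonneg β (fun _ => ⟨zero_le_one, le_rfl⟩) α

lemma bulkDensity_mono {β α α' : ℝ} (hβ : 0 < β) (h : α ≤ α') (hα' : α' < 0) :
    bulkDensity ν β α ≤ bulkDensity ν β α' :=
  bulkSeries_mono hβ (fun _ => ⟨zero_le_one, le_rfl⟩) h hα'

lemma continuousOn_bulkDensity {β : ℝ} (hβ : 0 < β) :
    ContinuousOn (bulkDensity ν β) (Set.Iio 0) :=
  continuousOn_bulkSeries hβ fun _ => ⟨zero_le_one, le_rfl⟩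

lemma continuousOn_bulkPressure {β : ℝ} (hβ : 0 < β) :
    ContinuousOn (bulkPressure ν β) (Set.Iio 0) := by
  refine (continuousOn_bulkSeries hβ fun j => ⟨by positivity, ?_⟩).div_const β
  exact div_le_one_of_le₀ (by linarith [(Nat.cast_nonneg j : (0 : ℝ) ≤ j)]) (by positivity)

end Perfect

/-! ### Diagonal operators on the Fock space -/

section Operators

section DiagonalOperator

variable {α : Type*}

lemma norm_ofReal_mul_le {g : α → ℝ} {C : ℝ} (hg : ∀ n, 0 ≤ g n) (hC : ∀ n, g n ≤ C)
    (f : lp (fun _ : α => ℂ) 2) (n : α) : ‖(g n : ℂ) * f n‖ ≤ C * ‖f n‖ := by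
  rw [norm_mul, Complex.norm_real, Real.norm_of_nonneg (hg n)]
  exact mul_le_mul_of_nonneg_right (hC n) (norm_nonneg _)

/-- Multiplication by a bounded nonnegative function, as an operator on `ℓ²`. -/
def diagonalOp (g : α → ℝ) (C : ℝ) (hg : ∀ n, 0 ≤ g n) (hC : ∀ n, g n ≤ C) :
    lp (fun _ : α => ℂ) 2 →L[ℂ] lp (fun _ : α => ℂ) 2 :=
  LinearMap.mkContinuous
    { toFun := fun f => ⟨fun n => (g n : ℂ) * f n, by
        have h : Memℓp (fun n => (C : ℂ) • f n) 2 := (lp.memℓp f).const_smul (C : ℂ)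
        refine h.mono' fun n => ?_
        refine (norm_ofReal_mul_le hg hC f n).trans ?_
        rw [norm_smul, Complex.norm_real]
        exact mul_le_mul_of_nonneg_right (le_abs_self C) (norm_nonneg _)⟩
      map_add' := fun f h => by
        ext n
        exact mul_add _ _ _
      map_smul' := fun c f => by
        ext n
        simp [mul_left_comm] }
    |C| fun f => (lp.norm_mono (y := (C : ℂ) • f) two_ne_zero fun n => by
      refine (norm_ofReal_mul_le hg hC f n).trans ?_
      rw [lp.coeFn_smul, Pi.smul_apply, norm_smul, Complex.norm_real]
      exact mul_le_mul_of_nonneg_right (le_abs_self C) (norm_nonneg _)).trans_eq (by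
        rw [norm_smul, Complex.norm_real, Real.norm_eq_abs])

lemma diagonalOp_apply {g : α → ℝ} {C : ℝ} (hg : ∀ n, 0 ≤ g n) (hC : ∀ n, g n ≤ C)
    (f : lp (fun _ : α => ℂ) 2) (n : α) : diagonalOp g C hg hC f n = (g n : ℂ) * f n := rfl

lemma isPositive_diagonalOp {g : α → ℝ} {C : ℝ} (hg : ∀ n, 0 ≤ g n) (hC : ∀ n, g n ≤ C) :
    (diagonalOp g C hg hC).IsPositive := by
  constructor
  · intro f h
    simp only [ContinuousLinearMap.coe_coe, lp.inner_eq_tsum, diagonalOp_apply]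
    refine tsum_congr fun n => ?_
    simp [RCLike.inner_apply]
    ring
  · intro f
    rw [ContinuousLinearMap.reApplyInnerSelf_apply, lp.inner_eq_tsum,
      ← RCLike.reCLM_apply, ContinuousLinearMap.map_tsum _ (lp.summable_inner _ _)]
    refine tsum_nonneg fun n => ?_
    have : inner ℂ (diagonalOp g C hg hC f n) (f n) = ((g n * Complex.normSq (f n) : ℝ) : ℂ) := by
      rw [diagonalOp_apply, RCLike.inner_apply, map_mul, Complex.conj_ofReal, Complex.ofReal_mul,
        Complex.normSq_eq_conj_mul_self]
      ring
    rw [this]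
    simpa using mul_nonneg (hg n) (Complex.normSq_nonneg _)

end DiagonalOperator

variable {ν : ℕ}

lemma opOfKet_ket (f : Config ν → AlgFock ν) (n : Config ν) : opOfKet f (ket n) = f n := by
  simp [opOfKet, ket]

lemma toFock_ket (n : Config ν) : toFock ν (ket n) = lp.single 2 n (1 : ℂ) := by
  simp [toFock, ket]

lemma modeNumber_ket (k : Mode ν) (n : Config ν) :
    modeNumber k (ket n) = ((n k : ℝ) : ℂ) • ket n := by
  rw [modeNumber, Module.End.mul_apply, annihilation, opOfKet_ket, map_smul, creation, opOfKet_ket,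
    smul_smul, ← Complex.ofReal_mul]
  rcases Nat.eq_zero_or_pos (n k) with h | h
  · simp [h]
  · have hle : Finsupp.single k 1 ≤ n := Finsupp.single_le_iff.2 h
    have hk : (((n - Finsupp.single k 1 : Config ν) k : ℕ) : ℝ) + 1 = n k := by
      rw [Finsupp.tsub_apply, Finsupp.single_eq_same, Nat.cast_sub h]
      simp
    rw [tsub_add_cancel_of_le hle, hk, Real.mul_self_sqrt (Nat.cast_nonneg _)]

lemma modeSum_ket (c : Mode ν → ℝ) (n : Config ν) :
    modeSum c (ket n) = ((n.sum fun k m => c k * m : ℝ) : ℂ) • ket n := by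
  rw [modeSum, opOfKet_ket, finsum_eq_sum_of_support_subset (s := n.support), Finsupp.sum,
    Complex.ofReal_sum, Finset.sum_smul]
  · refine Finset.sum_congr rfl fun k _ => ?_
    rw [modeNumber_ket, smul_smul, Complex.ofReal_mul]
  · intro k hk
    rw [Finset.mem_coe, Finsupp.mem_support_iff]
    intro h
    exact hk (by simp [modeNumber_ket, h])

lemma totalNumber_ket (n : Config ν) : totalNumber ν (ket n) = ((n.degree : ℝ) : ℂ) • ket n := by
  rw [totalNumber, modeSum_ket]
  simp [Finsupp.sum, Finsupp.degree_apply]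

/-- The eigenvalue of the exponent `-β(H - μN)` of the mean-field gas with gap `δ` at the occupation
numbers `n`. -/
def gibbsLevel (ν : ℕ) (L δ lam β μ : ℝ) (n : Config ν) : ℝ :=
  -β * ((n.sum fun k m => kineticEnergy ν L k * m) - δ * n 0 +
    lam / (2 * boxVolume ν L) * (n.degree : ℝ) ^ 2 - μ * n.degree)

lemma kinetic_ket (L δ : ℝ) (n : Config ν) : kinetic ν L δ (ket n) =
    (((n.sum fun k m => kineticEnergy ν L k * m) - δ * n 0 : ℝ) : ℂ) • ket n := by
  rw [kinetic, LinearMap.sub_apply, LinearMap.smul_apply, modeSum_ket, modeNumber_ket, smul_smul,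
    ← sub_smul]
  push_cast
  rfl

lemma gibbsExponent_ket {H : Module.End ℂ (AlgFock ν)} {E : ℝ} {n : Config ν}
    (h : H (ket n) = (E : ℂ) • ket n) (β μ : ℝ) :
    gibbsExponent H β μ (ket n) = ((-β * (E - μ * n.degree) : ℝ) : ℂ) • ket n := by
  rw [gibbsExponent, LinearMap.smul_apply, LinearMap.sub_apply, LinearMap.smul_apply, h,
    totalNumber_ket, smul_smul, ← sub_smul, smul_smul]
  push_cast
  rfl

lemma gibbsExponent_meanField_ket (L δ lam β μ : ℝ) (n : Config ν) :
    gibbsExponent (meanFieldHamiltonian ν L δ lam) β μ (ket n) =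
      (gibbsLevel ν L δ lam β μ n : ℂ) • ket n := by
  refine gibbsExponent_ket ?_ β μ
  rw [meanFieldHamiltonian, LinearMap.add_apply, LinearMap.smul_apply, kinetic_ket, pow_two,
    Module.End.mul_apply, totalNumber_ket, map_smul, totalNumber_ket, smul_smul, smul_smul,
    ← add_smul]
  push_cast
  ring_nf

lemma gibbsExponent_kinetic_ket (L β μ : ℝ) (n : Config ν) :
    gibbsExponent (kinetic ν L 0) β μ (ket n) = (gibbsLevel ν L 0 0 β μ n : ℂ) • ket n := by
  rw [gibbsExponent_ket (kinetic_ket L 0 n), gibbsLevel]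
  simp

section Exponential

variable {A B : Module.End ℂ (AlgFock ν)} {a b : Config ν → ℝ}

lemma pow_ket (hA : ∀ n, A (ket n) = (a n : ℂ) • ket n) (j : ℕ) (n : Config ν) :
    (A ^ j) (ket n) = ((a n : ℂ) ^ j) • ket n := by
  induction j with
  | zero => simp
  | succ j ih => rw [pow_succ', Module.End.mul_apply, ih, map_smul, hA, smul_smul, pow_succ]

lemma hasSum_exp_ket (hA : ∀ n, A (ket n) = (a n : ℂ) • ket n) (n : Config ν) :
    HasSum (fun j : ℕ => ((Nat.factorial j : ℂ)⁻¹) • toFock ν ((A ^ j) (ket n)))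
      ((Real.exp (a n) : ℂ) • toFock ν (ket n)) := by
  have h := (NormedSpace.exp_series_hasSum_exp' (𝕂 := ℂ) (a n : ℂ)).smul_const (toFock ν (ket n))
  rw [← Complex.exp_eq_exp_ℂ, ← Complex.ofReal_exp] at h
  convert h using 1
  funext j
  rw [pow_ket hA, map_smul, smul_smul, smul_eq_mul]

lemma diagElement_eq (hA : ∀ n, A (ket n) = (a n : ℂ) • ket n)
    (hB : ∀ n, B (ket n) = (b n : ℂ) • ket n) (n : Config ν) :
    diagElement A B n = ((b n * Real.exp (a n) : ℝ) : ℂ) := by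
  have h := (hasSum_exp_ket hA n).const_smul (b n : ℂ)
  have hexp : expOn A (B (ket n)) = (b n : ℂ) • ((Real.exp (a n) : ℂ) • toFock ν (ket n)) := by
    rw [expOn, ← h.tsum_eq]
    refine tsum_congr fun j => ?_
    rw [hB, map_smul, map_smul, smul_comm]
  rw [diagElement, hexp, inner_smul_right, inner_smul_right, toFock_ket, lp.inner_single_left]
  simp

lemma traceExp_eq (hA : ∀ n, A (ket n) = (a n : ℂ) • ket n)
    (hB : ∀ n, B (ket n) = (b n : ℂ) • ket n) :
    traceExp A B = ((∑' n, b n * Real.exp (a n) : ℝ) : ℂ) := by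
  rw [traceExp, Complex.ofReal_tsum]
  exact tsum_congr fun n => diagElement_eq hA hB n

lemma isTraceClassExp_of_summable (hA : ∀ n, A (ket n) = (a n : ℂ) • ket n)
    (hs : Summable fun n => Real.exp (a n)) : IsTraceClassExp A := by
  have hle : ∀ n, Real.exp (a n) ≤ ∑' m, Real.exp (a m) := fun n =>
    hs.le_tsum n fun m _ => Real.exp_nonneg _
  have hG : ∀ n : Config ν, diagonalOp _ _ (fun n => Real.exp_nonneg (a n)) hle (toFock ν (ket n)) =
      (Real.exp (a n) : ℂ) • toFock ν (ket n) := fun n => by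
    ext m
    rw [diagonalOp_apply, toFock_ket, lp.coeFn_smul, Pi.smul_apply, smul_eq_mul]
    by_cases h : m = n
    · rw [h]
    · rw [lp.single_apply_ne _ _ _ h, mul_zero, mul_zero]
  refine ⟨diagonalOp _ _ (fun n => Real.exp_nonneg (a n)) hle, isPositive_diagonalOp _ _,
    fun ψ => ?_, ?_⟩
  · induction ψ using Finsupp.induction_linear with
    | zero => simp
    | add f g hf hg => simpa only [map_add, smul_add] using hf.add hg
    | single n c =>
      have hc : (Finsupp.single n c : AlgFock ν) = c • ket n := by simp [ket]
      have h := (hasSum_exp_ket hA n).const_smul c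
      rw [hc, map_smul, map_smul, hG]
      convert h using 1
      funext j
      rw [map_smul, map_smul, smul_comm]
  · refine (Complex.ofRealCLM.summable hs).congr fun n => ?_
    rw [hG, inner_smul_right, toFock_ket, lp.inner_single_left]
    simp

lemma one_ket (n : Config ν) : (1 : Module.End ℂ (AlgFock ν)) (ket n) = ((1 : ℝ) : ℂ) • ket n := by
  simp

end Exponential

lemma partitionFunction_meanField (L δ lam β μ : ℝ) :
    partitionFunction (meanFieldHamiltonian ν L δ lam) β μ =
      ∑' n, Real.exp (gibbsLevel ν L δ lam β μ n) := by
  rw [partitionFunction, traceExp_eq (gibbsExponent_meanField_ket L δ lam β μ) one_ket,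
    Complex.ofReal_re]
  simp

lemma partitionFunction_kinetic (L β μ : ℝ) :
    partitionFunction (kinetic ν L 0) β μ = ∑' n, Real.exp (gibbsLevel ν L 0 0 β μ n) := by
  rw [partitionFunction, traceExp_eq (gibbsExponent_kinetic_ket L β μ) one_ket,
    Complex.ofReal_re]
  simp

/-- The activities of the gas with gap `δ` at chemical potential `α`: only the mode `0` feels the
gap. -/
def gapActivity (ν : ℕ) (β L δ α : ℝ) (k : Mode ν) : ℝ :=
  if k = 0 then Real.exp (β * (α + δ)) else activity ν β L α k

lemma gapActivity_zero_gap (β L α : ℝ) : gapActivity ν β L 0 α = activity ν β L α := by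
  funext k
  by_cases hk : k = 0 <;> simp [gapActivity, activity, hk]

lemma weight_gapActivity (β L δ α : ℝ) (n : Config ν) :
    weight (gapActivity ν β L δ α) n = Real.exp (gibbsLevel ν L δ 0 β α n) := by
  have h0 : ∀ k ∈ n.support, gapActivity ν β L δ α k ^ n k = Real.exp
      (-β * (kineticEnergy ν L k * n k) + β * α * n k + if k = 0 then β * δ * n 0 else 0) := by
    intro k _
    by_cases hk : k = 0
    · subst hk
      simp only [gapActivity, if_true, kineticEnergy_zero, ← Real.exp_nat_mul]
      congr 1
      ring
    · simp only [gapActivity, hk, if_false, activity, ← Real.exp_nat_mul]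
      congr 1
      ring
  rw [weight, Finsupp.prod, Finset.prod_congr rfl h0, ← Real.exp_sum, gibbsLevel,
    Finset.sum_add_distrib, Finset.sum_add_distrib, ← Finset.mul_sum, ← Finset.mul_sum,
    Finset.sum_ite_eq', ← Nat.cast_sum, ← Finsupp.degree_apply, Finsupp.sum]
  congr 1
  split_ifs with h
  · ring
  · rw [Finsupp.notMem_support_iff.1 h]
    simp
    ring

lemma gibbsLevel_eq (L δ lam β μ α : ℝ) (n : Config ν) :
    gibbsLevel ν L δ lam β μ n = gibbsLevel ν L δ 0 β α n +
      β * ((μ - α) * n.degree - lam / (2 * boxVolume ν L) * (n.degree : ℝ) ^ 2) := by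
  rw [gibbsLevel, gibbsLevel]
  ring

end Operators

/-! ### The pressure of the mean-field gas -/

section MeanField

variable {ν : ℕ}

lemma subcritical_gapActivity {β L δ α : ℝ} (hβ : 0 < β) (hL : 0 < L) (hδ : 0 ≤ δ) (hα : α < -δ) :
    Subcritical (gapActivity ν β L δ α) (Real.exp (β * (α + δ))) := by
  have h := subcritical_activity (ν := ν) hβ hL (by linarith : α < 0)
  have hβδ : 0 ≤ β * δ := by positivity
  have hnonneg : ∀ k, 0 ≤ gapActivity ν β L δ α k := fun k => by
    unfold gapActivity
    split_ifs
    exacts [Real.exp_nonneg _, h.nonneg k]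
  refine ⟨hnonneg, fun k => ?_, Real.exp_lt_one_iff.2 (by nlinarith),
    (h.summable.mul_left (Real.exp (β * δ))).of_nonneg_of_le hnonneg fun k => ?_⟩
  · unfold gapActivity
    split_ifs
    · exact le_rfl
    · exact (h.le k).trans (Real.exp_le_exp.2 (by linarith))
  · unfold gapActivity
    split_ifs with hk
    · rw [hk, activity, ← Real.exp_add, kineticEnergy_zero]
      exact Real.exp_le_exp.2 (by linarith)
    · exact le_mul_of_one_le_left (h.nonneg k) (Real.one_le_exp hβδ)

/-- The activities of the perfect gas from which the mode `0` has been removed. -/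
def excitedActivity (ν : ℕ) (β L α : ℝ) (k : Mode ν) : ℝ :=
  if k = 0 then 0 else activity ν β L α k

lemma subcritical_excitedActivity {β L α : ℝ} (hβ : 0 < β) (hL : 0 < L) (hα : α < 0) :
    Subcritical (excitedActivity ν β L α) (Real.exp (β * α)) :=
  (subcritical_activity hβ hL hα).ite_zero (· = 0)

lemma log_freePartition_gapActivity {β L δ α : ℝ} (hβ : 0 < β) (hL : 0 < L) (hδ : 0 ≤ δ)
    (hα : α < -δ) :
    Real.log (freePartition (gapActivity ν β L δ α)) =
      Real.log (freePartition (excitedActivity ν β L α)) -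
        Real.log (1 - Real.exp (β * (α + δ))) := by
  have h := subcritical_gapActivity (ν := ν) hβ hL hδ hα
  have key := h.freePartition_remove 0
  have hex : (fun l : Mode ν => if l = 0 then 0 else gapActivity ν β L δ α l) =
      excitedActivity ν β L α := by
    funext l
    by_cases hl : l = 0 <;> simp [excitedActivity, gapActivity, hl]
  have h0 : gapActivity ν β L δ α 0 = Real.exp (β * (α + δ)) := if_pos rfl
  rw [hex, h0] at key
  rw [key, Real.log_mul (sub_pos.2 h.lt_one).ne' h.freePartition_pos.ne']
  ring

lemma meanNumber_excitedActivity {β L α : ℝ} (hβ : 0 < β) (hL : 0 < L) (hα : α < 0) :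
    meanNumber (excitedActivity ν β L α) =
      meanNumber (activity ν β L α) - Real.exp (β * α) / (1 - Real.exp (β * α)) := by
  have h := (subcritical_activity (ν := ν) hβ hL hα).hasSum_meanNumber.summable.tsum_eq_add_tsum_ite
    0
  have h0 : activity ν β L α 0 = Real.exp (β * α) := by simp [activity]
  have hex : meanNumber (excitedActivity ν β L α) = ∑' k : Mode ν, if k = 0 then 0 else
      activity ν β L α k / (1 - activity ν β L α k) := by
    refine tsum_congr fun k => ?_
    by_cases hk : k = 0 <;> simp [excitedActivity, hk]
  rw [h0, ← hex, ← meanNumber] at h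
  rw [h]
  ring

section Volume

lemma tendsto_const_div_boxVolume (hν : 1 ≤ ν) (c : ℝ) :
    Tendsto (fun L => c / boxVolume ν L) atTop (𝓝 0) :=
  tendsto_const_nhds.div_atTop (tendsto_boxVolume hν)

lemma tendsto_meanNumber_excitedActivity (hν : 1 ≤ ν) {β α : ℝ} (hβ : 0 < β) (hα : α < 0) :
    Tendsto (fun L => meanNumber (excitedActivity ν β L α) / boxVolume ν L) atTop
      (𝓝 (bulkDensity ν β α)) := by
  have h := (tendsto_meanNumber_activity (ν := ν) hβ hα).sub
    (tendsto_const_div_boxVolume hν (Real.exp (β * α) / (1 - Real.exp (β * α))))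
  rw [sub_zero] at h
  refine h.congr' ?_
  filter_upwards [eventually_gt_atTop 0] with L hL
  rw [meanNumber_excitedActivity hβ hL hα, sub_div]

lemma tendsto_log_freePartition_excitedActivity (hν : 1 ≤ ν) {β α : ℝ} (hβ : 0 < β) (hα : α < 0) :
    Tendsto (fun L => Real.log (freePartition (excitedActivity ν β L α)) / (β * boxVolume ν L))
      atTop (𝓝 (bulkPressure ν β α)) := by
  have h := (tendsto_log_freePartition_activity (ν := ν) hβ hα).add
    (tendsto_const_div_boxVolume hν (Real.log (1 - Real.exp (β * α)) / β))
  rw [add_zero] at h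
  refine h.congr' ?_
  filter_upwards [eventually_gt_atTop 0] with L hL
  have := log_freePartition_gapActivity (ν := ν) hβ hL le_rfl (by linarith : α < -0)
  rw [gapActivity_zero_gap, add_zero] at this
  rw [this, div_div, ← add_div, sub_add_cancel]

lemma tendsto_log_freePartition_gapActivity (hν : 1 ≤ ν) {β δ α : ℝ} (hβ : 0 < β) (hδ : 0 ≤ δ)
    (hα : α < -δ) :
    Tendsto (fun L => Real.log (freePartition (gapActivity ν β L δ α)) / (β * boxVolume ν L))
      atTop (𝓝 (bulkPressure ν β α)) := by
  have h := (tendsto_log_freePartition_excitedActivity hν hβ (by linarith : α < 0)).sub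
    (tendsto_const_div_boxVolume hν (Real.log (1 - Real.exp (β * (α + δ))) / β))
  rw [sub_zero] at h
  refine h.congr' ?_
  filter_upwards [eventually_gt_atTop 0] with L hL
  rw [log_freePartition_gapActivity hβ hL hδ hα, div_div, ← sub_div]

end Volume

/-- Completing the square in the particle number bounds the mean-field weights by those of the
perfect gas with gap at any chemical potential. -/
lemma exp_gibbsLevel_le {L δ lam β μ α : ℝ} (hβ : 0 < β) (hlam : 0 < lam) (hL : 0 < L)
    (n : Config ν) :
    Real.exp (gibbsLevel ν L δ lam β μ n) ≤
      Real.exp (β * (boxVolume ν L * ((μ - α) ^ 2 / (2 * lam)))) *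
        weight (gapActivity ν β L δ α) n := by
  have hV := boxVolume_pos (ν := ν) hL
  rw [weight_gapActivity, ← Real.exp_add, gibbsLevel_eq L δ lam β μ α, Real.exp_le_exp, add_comm]
  refine add_le_add_left (mul_le_mul_of_nonneg_left ?_ hβ.le) _
  have : boxVolume ν L * ((μ - α) ^ 2 / (2 * lam)) -
      ((μ - α) * n.degree - lam / (2 * boxVolume ν L) * (n.degree : ℝ) ^ 2) =
      (boxVolume ν L * (μ - α) - lam * n.degree) ^ 2 / (2 * lam * boxVolume ν L) := by
    field_simp
    ring
  have h2 : 0 ≤ (boxVolume ν L * (μ - α) - lam * n.degree) ^ 2 / (2 * lam * boxVolume ν L) := by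
    positivity
  linarith

lemma summable_exp_gibbsLevel {L δ lam β : ℝ} (hβ : 0 < β) (hlam : 0 < lam) (hL : 0 < L)
    (hδ : 0 ≤ δ) (μ : ℝ) : Summable fun n : Config ν => Real.exp (gibbsLevel ν L δ lam β μ n) :=
  ((subcritical_gapActivity hβ hL hδ (sub_one_lt (-δ))).summable_weight.mul_left _).of_nonneg_of_le
    (fun _ => Real.exp_nonneg _) fun n => exp_gibbsLevel_le hβ hlam hL n

lemma finiteMeanFieldPressure_eq (δ lam β μ L : ℝ) :
    finiteMeanFieldPressure ν δ lam β μ L =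
      Real.log (∑' n, Real.exp (gibbsLevel ν L δ lam β μ n)) / (β * boxVolume ν L) := by
  rw [finiteMeanFieldPressure, finitePressure, partitionFunction_meanField]
  ring

lemma finiteMeanFieldPressure_le {L δ lam β μ α : ℝ} (hβ : 0 < β) (hlam : 0 < lam) (hL : 0 < L)
    (hδ : 0 ≤ δ) (hα : α < -δ) :
    finiteMeanFieldPressure ν δ lam β μ L ≤ (μ - α) ^ 2 / (2 * lam) +
      Real.log (freePartition (gapActivity ν β L δ α)) / (β * boxVolume ν L) := by
  have hV := boxVolume_pos (ν := ν) hL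
  have h := subcritical_gapActivity (ν := ν) hβ hL hδ hα
  have hs := summable_exp_gibbsLevel (ν := ν) hβ hlam hL hδ μ
  rw [finiteMeanFieldPressure_eq, div_le_iff₀ (by positivity)]
  calc Real.log (∑' n, Real.exp (gibbsLevel ν L δ lam β μ n))
      ≤ Real.log (Real.exp (β * (boxVolume ν L * ((μ - α) ^ 2 / (2 * lam)))) *
          freePartition (gapActivity ν β L δ α)) := by
        refine Real.log_le_log (hs.tsum_pos (fun _ => Real.exp_nonneg _) 0 (Real.exp_pos _)) ?_
        rw [freePartition, ← tsum_mul_left]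
        exact hs.tsum_le_tsum (fun n => exp_gibbsLevel_le hβ hlam hL n)
          (h.summable_weight.mul_left _)
    _ = _ := by
        rw [Real.log_mul (Real.exp_pos _).ne' h.freePartition_pos.ne', Real.log_exp]
        field_simp

/-- The weight of the excited modes, times the exponential of the energy gained by adding `m`
particles to the mode `0`, is at most a term of the mean-field partition function. -/
lemma weight_excited_mul_exp_le (L δ lam β μ α : ℝ) (m : ℕ) (n : Config ν) :
    weight (excitedActivity ν β L α) n * Real.exp (β * ((μ + δ) * m + (μ - α) * n.degree -
        lam / (2 * boxVolume ν L) * (m + (n.degree : ℝ)) ^ 2)) ≤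
      Real.exp (gibbsLevel ν L δ lam β μ (n + Finsupp.single 0 m)) := by
  by_cases h0 : n 0 = 0
  · have hw : weight (excitedActivity ν β L α) n = Real.exp (gibbsLevel ν L 0 0 β α n) := by
      rw [← weight_gapActivity, gapActivity_zero_gap]
      exact (weight_ite_zero _ (· = 0) n).1 fun k hk => hk ▸ h0
    rw [hw, ← Real.exp_add]
    refine le_of_eq (congrArg Real.exp ?_)
    have he : ((n + Finsupp.single 0 m).sum fun k j => kineticEnergy ν L k * (j : ℝ)) =
        n.sum fun k j => kineticEnergy ν L k * (j : ℝ) := by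
      rw [Finsupp.sum_add_index' (by simp) (by intros; push_cast; ring),
        Finsupp.sum_single_index (by simp)]
      simp
    rw [gibbsLevel, gibbsLevel, he, map_add, Finsupp.degree_single, Finsupp.add_apply, h0]
    simp
    ring
  · have hw : weight (excitedActivity ν β L α) n = 0 :=
      (weight_ite_zero _ (· = 0) n).2 0 rfl h0
    rw [hw, zero_mul]
    exact Real.exp_nonneg _

/-- Lower bound on the pressure: put `m` particles into the mode `0`, and apply Jensen's inequality
to the Gibbs state of the excited modes at chemical potential `α`. -/
lemma le_finiteMeanFieldPressure {L δ lam β μ α : ℝ} (hβ : 0 < β) (hlam : 0 < lam) (hL : 0 < L)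
    (hδ : 0 ≤ δ) (hα : α < 0) (m : ℕ) :
    Real.log (freePartition (excitedActivity ν β L α)) / (β * boxVolume ν L) +
      ((μ + δ) * (m / boxVolume ν L) +
        (μ - α) * (meanNumber (excitedActivity ν β L α) / boxVolume ν L) -
        lam / 2 * ((m / boxVolume ν L + meanNumber (excitedActivity ν β L α) / boxVolume ν L) ^ 2 +
          meanNumber (excitedActivity ν β L α) / boxVolume ν L *
            (1 / (1 - Real.exp (β * α)) / boxVolume ν L))) ≤
      finiteMeanFieldPressure ν δ lam β μ L := by
  have hV := boxVolume_pos (ν := ν) hL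
  set V := boxVolume ν L with hVdef
  have h := subcritical_excitedActivity (ν := ν) hβ hL hα
  set x := excitedActivity ν β L α with hx
  set q := meanNumber x
  set r := Real.exp (β * α)
  have hZ := h.freePartition_pos
  have hs := summable_exp_gibbsLevel (ν := ν) hβ hlam hL hδ μ
  have hinj := add_left_injective (Finsupp.single (0 : Mode ν) m)
  have hs' : Summable fun n : Config ν =>
      Real.exp (gibbsLevel ν L δ lam β μ (n + Finsupp.single 0 m)) := hs.comp_injective hinj
  have hshift : ∑' n : Config ν, Real.exp (gibbsLevel ν L δ lam β μ (n + Finsupp.single 0 m)) ≤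
      ∑' n, Real.exp (gibbsLevel ν L δ lam β μ n) :=
    hs'.tsum_le_tsum_of_inj _ hinj (fun _ _ => Real.exp_nonneg _) (fun _ => le_rfl) hs
  set g : Config ν → ℝ := fun n => β * ((μ + δ) * m + (μ - α) * n.degree -
        lam / (2 * V) * (m + (n.degree : ℝ)) ^ 2) with hg
  have hs1 : Summable fun n : Config ν => (n.degree : ℝ) * weight x n := by
    simpa using h.summable_degree_pow 1
  have hs2 := h.summable_degree_pow 2
  have hexpand : ∀ n : Config ν, weight x n * g n =
      (β * ((μ + δ) * m - lam / (2 * V) * m ^ 2)) * weight x n +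
      (β * (μ - α - lam / V * m)) * ((n.degree : ℝ) * weight x n) -
      (β * (lam / (2 * V))) * ((n.degree : ℝ) ^ 2 * weight x n) := fun n => by
    simp only [hg]
    field_simp
    ring
  have hs0 := (h.summable_weight.mul_left (β * ((μ + δ) * m - lam / (2 * V) * m ^ 2)))
  have hs1' := hs1.mul_left (β * (μ - α - lam / V * m))
  have hs2' := hs2.mul_left (β * (lam / (2 * V)))
  have hsg : Summable fun n => weight x n * g n :=
    ((hs0.add hs1').sub hs2').congr fun n => (hexpand n).symm
  have hmean : β * ((μ + δ) * m + (μ - α) * q - lam / (2 * V) * ((m + q) ^ 2 + q / (1 - r))) ≤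
      (∑' n, weight x n * g n) / freePartition x := by
    rw [le_div_iff₀ hZ, tsum_congr hexpand, (hs0.add hs1').tsum_sub hs2', hs0.tsum_add hs1',
      tsum_mul_left, tsum_mul_left, tsum_mul_left, h.tsum_degree_weight, ← freePartition]
    have hle := mul_le_mul_of_nonneg_left h.tsum_degree_sq_weight_le
      (by positivity : 0 ≤ β * (lam / (2 * V)))
    refine le_trans (le_of_eq ?_) (sub_le_sub_left hle _)
    field_simp
    ring
  have hJ := tsum_mul_exp_mean_le (weight_nonneg h.nonneg) h.summable_weight hZ hsg hs'
    fun n => weight_excited_mul_exp_le L δ lam β μ α m n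
  have hlog := Real.log_le_log (mul_pos hZ (Real.exp_pos _)) (hJ.trans hshift)
  rw [← freePartition, Real.log_mul hZ.ne' (Real.exp_pos _).ne', Real.log_exp] at hlog
  rw [finiteMeanFieldPressure_eq, le_div_iff₀ (by positivity)]
  refine le_trans (le_of_eq ?_) ((add_le_add_right hmean _).trans hlog)
  rw [← hVdef]
  field_simp

/-- The pressure of the perfect gas at chemical potential `α`, raised by the mean field. The
mean-field pressure is the infimum of this function over all `α` below minus the gap. -/
def trialPressure (ν : ℕ) (lam β μ α : ℝ) : ℝ := (μ - α) ^ 2 / (2 * lam) + bulkPressure ν β α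

section Limit

variable {δ lam β μ : ℝ}

lemma exists_tendsto_finiteMeanFieldPressure_le (hν : 1 ≤ ν) (hβ : 0 < β) (hlam : 0 < lam)
    (hδ : 0 ≤ δ) {α : ℝ} (hα : α < -δ) :
    ∃ F : ℝ → ℝ, Tendsto F atTop (𝓝 (trialPressure ν lam β μ α)) ∧
      ∀ᶠ L in atTop, finiteMeanFieldPressure ν δ lam β μ L ≤ F L :=
  ⟨_, (tendsto_log_freePartition_gapActivity hν hβ hδ hα).const_add _,
    (eventually_gt_atTop 0).mono fun _ hL => finiteMeanFieldPressure_le hβ hlam hL hδ hα⟩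

lemma exists_tendsto_le_finiteMeanFieldPressure (hν : 1 ≤ ν) (hβ : 0 < β) (hlam : 0 < lam)
    (hδ : 0 ≤ δ) {α x : ℝ} (hα : α < 0) (hx : 0 ≤ x) (hxα : lam * (x + bulkDensity ν β α) = μ - α) :
    ∃ F : ℝ → ℝ, Tendsto F atTop (𝓝 (trialPressure ν lam β μ α + (α + δ) * x)) ∧
      ∀ᶠ L in atTop, F L ≤ finiteMeanFieldPressure ν δ lam β μ L := by
  have hm : Tendsto (fun L => (⌊x * boxVolume ν L⌋₊ : ℝ) / boxVolume ν L) atTop (𝓝 x) :=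
    (tendsto_nat_floor_mul_div_atTop hx).comp (tendsto_boxVolume hν)
  have hq := tendsto_meanNumber_excitedActivity hν hβ hα
  have hlim := (tendsto_log_freePartition_excitedActivity hν hβ hα).add
    (((hm.const_mul (μ + δ)).add (hq.const_mul (μ - α))).sub ((((hm.add hq).pow 2).add
      (hq.mul (tendsto_const_div_boxVolume hν (1 / (1 - Real.exp (β * α)))))).const_mul (lam / 2)))
  refine ⟨_, ?_, (eventually_gt_atTop 0).mono fun L hL =>
    le_finiteMeanFieldPressure hβ hlam hL hδ hα ⌊x * boxVolume ν L⌋₊⟩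
  convert hlim using 2
  have hμ : μ = lam * (x + bulkDensity ν β α) + α := by linarith
  rw [trialPressure, hμ]
  field_simp
  ring

/-- If the density of the perfect gas at some `α` below minus the gap is the one that the mean field
asks for, then there is no condensate, and the gap is not felt. -/
lemma tendsto_of_balance (hν : 1 ≤ ν) (hβ : 0 < β) (hlam : 0 < lam) (hδ : 0 ≤ δ) {α : ℝ}
    (hα : α < -δ) (h : lam * bulkDensity ν β α = μ - α) :
    Tendsto (finiteMeanFieldPressure ν δ lam β μ) atTop (𝓝 (trialPressure ν lam β μ α)) := by
  obtain ⟨F, hF, hFle⟩ := exists_tendsto_finiteMeanFieldPressure_le hν hβ hlam hδ hα (μ := μ)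
  obtain ⟨G, hG, hGle⟩ := exists_tendsto_le_finiteMeanFieldPressure hν hβ hlam hδ
    (by linarith : α < 0) le_rfl (by rw [zero_add, h])
  rw [mul_zero, add_zero] at hG
  exact tendsto_of_tendsto_of_tendsto_of_le_of_le' hG hF hGle hFle

/-- If the mean field asks for more particles than the perfect gas holds at `α`, then putting the
rest into the mode `0` loses a term that vanishes as `α` tends to minus the gap. -/
lemma exists_tendsto_le_of_deficit (hν : 1 ≤ ν) (hβ : 0 < β) (hlam : 0 < lam) (hδ : 0 ≤ δ) {α : ℝ}
    (hα : α < -δ) (h : lam * bulkDensity ν β α ≤ μ - α) :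
    ∃ F : ℝ → ℝ, Tendsto F atTop
        (𝓝 (trialPressure ν lam β μ α + (α + δ) * ((μ - α) / lam))) ∧
      ∀ᶠ L in atTop, F L ≤ finiteMeanFieldPressure ν δ lam β μ L := by
  have hx : 0 ≤ (μ - α) / lam - bulkDensity ν β α := by
    rw [sub_nonneg, le_div_iff₀ hlam]
    linarith
  obtain ⟨G, hG, hGle⟩ := exists_tendsto_le_finiteMeanFieldPressure hν hβ hlam hδ
    (by linarith : α < 0) hx (by rw [sub_add_cancel, mul_div_cancel₀ _ hlam.ne'] : _ = μ - α)
  refine ⟨fun L => G L + (α + δ) * bulkDensity ν β α, ?_, hGle.mono fun L hL => ?_⟩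
  · have := hG.add_const ((α + δ) * bulkDensity ν β α)
    convert this using 2
    ring
  · have := mul_nonpos_of_nonpos_of_nonneg (by linarith : α + δ ≤ 0)
      (bulkDensity_nonneg (ν := ν) β α)
    linarith

lemma tendsto_deficit_energy (δ lam μ : ℝ) :
    Tendsto (fun α => (α + δ) * ((μ - α) / lam)) (𝓝[<] (-δ)) (𝓝 0) := by
  have : Continuous fun α : ℝ => (α + δ) * ((μ - α) / lam) := by fun_prop
  simpa using (this.tendsto (-δ)).mono_left nhdsWithin_le_nhds

lemma exists_tendsto_of_deficit (hν : 1 ≤ ν) (hβ : 0 < β) (hlam : 0 < lam) (hδ : 0 ≤ δ)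
    (h : ∀ α < -δ, lam * bulkDensity ν β α ≤ μ - α) :
    ∃ p, Tendsto (finiteMeanFieldPressure ν δ lam β μ) atTop (𝓝 p) ∧
      ∀ α < -δ, p ≤ trialPressure ν lam β μ α ∧
        trialPressure ν lam β μ α + (α + δ) * ((μ - α) / lam) ≤ p := by
  have hcauchy : CauchySeq (finiteMeanFieldPressure ν δ lam β μ) := by
    refine Metric.cauchySeq_iff'.2 fun ε hε => ?_
    obtain ⟨α, hαε, hα⟩ := (((tendsto_deficit_energy δ lam μ).eventually_const_lt
      (by linarith : -(ε / 4) < 0)).and self_mem_nhdsWithin).exists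
    obtain ⟨F, hF, hFle⟩ := exists_tendsto_finiteMeanFieldPressure_le hν hβ hlam hδ hα (μ := μ)
    obtain ⟨G, hG, hGle⟩ := exists_tendsto_le_of_deficit hν hβ hlam hδ hα (h α hα)
    obtain ⟨N, hN⟩ := eventually_atTop.1 (hFle.and (hGle.and
      ((hF.eventually_lt_const (lt_add_of_pos_right _ (by linarith : 0 < ε / 4))).and
      (hG.eventually_const_lt (sub_lt_self _ (by linarith : 0 < ε / 4))))))
    have hclose : ∀ L ≥ N, trialPressure ν lam β μ α - ε / 2 <
        finiteMeanFieldPressure ν δ lam β μ L ∧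
        finiteMeanFieldPressure ν δ lam β μ L < trialPressure ν lam β μ α + ε / 4 := fun L hL => by
      obtain ⟨h1, h2, h3, h4⟩ := hN L hL
      constructor <;> linarith
    refine ⟨N, fun L hL => ?_⟩
    have h1 := hclose L hL
    have h2 := hclose N le_rfl
    rw [Real.dist_eq, abs_lt]
    constructor <;> linarith
  obtain ⟨p, hp⟩ := cauchySeq_tendsto_of_complete hcauchy
  refine ⟨p, hp, fun α hα => ⟨?_, ?_⟩⟩
  · obtain ⟨F, hF, hFle⟩ := exists_tendsto_finiteMeanFieldPressure_le hν hβ hlam hδ hα (μ := μ)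
    exact le_of_tendsto_of_tendsto hp hF hFle
  · obtain ⟨G, hG, hGle⟩ := exists_tendsto_le_of_deficit hν hβ hlam hδ hα (h α hα)
    exact le_of_tendsto_of_tendsto hG hp hGle

/-- By the intermediate value theorem, a balance exists unless the mean field asks for too many
particles at every admissible `α`. -/
lemma exists_balance_or_deficit (hβ : 0 < β) (hlam : 0 < lam) (hδ : 0 ≤ δ) (μ : ℝ) :
    (∃ α < -δ, lam * bulkDensity ν β α = μ - α) ∨
      ∀ α < -δ, lam * bulkDensity ν β α ≤ μ - α := by
  by_contra! hcon
  obtain ⟨hne, α₀, hα₀, hlt⟩ := hcon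
  set α₁ := min α₀ (μ - lam * bulkDensity ν β α₀)
  have h10 : α₁ ≤ α₀ := min_le_left _ _
  have h1 : lam * bulkDensity ν β α₁ ≤ μ - α₁ := by
    have h2 := mul_le_mul_of_nonneg_left
      (bulkDensity_mono (ν := ν) hβ h10 (by linarith : α₀ < 0)) hlam.le
    have h3 : α₁ ≤ μ - lam * bulkDensity ν β α₀ := min_le_right _ _
    linarith
  have hcont : ContinuousOn (fun α => lam * bulkDensity ν β α + α) (Set.Icc α₁ α₀) :=
    (((continuousOn_bulkDensity hβ).mono fun α hα => hα.2.trans_lt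
      (by linarith : α₀ < 0)).const_mul lam).add continuousOn_id
  obtain ⟨α, hα, hval⟩ := intermediate_value_Icc h10 hcont
    (⟨by linarith, by linarith⟩ : μ ∈ Set.Icc _ _)
  exact hne α (hα.2.trans_lt hα₀) (by simp only at hval; linarith)

lemma exists_tendsto_finiteMeanFieldPressure (hν : 1 ≤ ν) (hβ : 0 < β) (hlam : 0 < lam)
    (hδ : 0 ≤ δ) (μ : ℝ) : ∃ p, Tendsto (finiteMeanFieldPressure ν δ lam β μ) atTop (𝓝 p) := by
  rcases exists_balance_or_deficit (ν := ν) hβ hlam hδ μ with ⟨α, hα, h⟩ | h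
  · exact ⟨_, tendsto_of_balance hν hβ hlam hδ hα h⟩
  · obtain ⟨p, hp, -⟩ := exists_tendsto_of_deficit hν hβ hlam hδ h
    exact ⟨p, hp⟩

lemma tendsto_nhdsLT_of_continuousOn {f : ℝ → ℝ} (hf : ContinuousOn f (Set.Iio 0)) (hδ : 0 < δ) :
    Tendsto f (𝓝[<] (-δ)) (𝓝 (f (-δ))) :=
  (hf.continuousAt (Iio_mem_nhds (neg_lt_zero.2 hδ))).tendsto.mono_left nhdsWithin_le_nhds

/-- With a positive gap and a deficit of particles, the mode `0` pins the chemical potential of the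
excited modes to minus the gap. -/
lemma tendsto_of_deficit (hν : 1 ≤ ν) (hβ : 0 < β) (hlam : 0 < lam) (hδ : 0 < δ)
    (h : ∀ α < -δ, lam * bulkDensity ν β α ≤ μ - α) :
    Tendsto (finiteMeanFieldPressure ν δ lam β μ) atTop (𝓝 (trialPressure ν lam β μ (-δ))) := by
  obtain ⟨p, hp, hbound⟩ := exists_tendsto_of_deficit hν hβ hlam hδ.le h
  have hcont : ContinuousOn (trialPressure ν lam β μ) (Set.Iio 0) :=
    ContinuousOn.add (by fun_prop) (continuousOn_bulkPressure hβ)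
  have hU := tendsto_nhdsLT_of_continuousOn hcont hδ
  have hU' := hU.add (tendsto_deficit_energy δ lam μ)
  rw [add_zero] at hU'
  have hmem : ∀ᶠ α in 𝓝[<] (-δ), α < -δ := self_mem_nhdsWithin
  rwa [le_antisymm (le_of_tendsto hU' (hmem.mono fun α hα => (hbound α hα).2))
    (ge_of_tendsto hU (hmem.mono fun α hα => (hbound α hα).1))]

end Limit

section Perfect

variable {β α : ℝ}

lemma tsum_exp_gibbsLevel_perfect (L : ℝ) :
    ∑' n : Config ν, Real.exp (gibbsLevel ν L 0 0 β α n) = freePartition (activity ν β L α) := by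
  simp only [← weight_gapActivity, gapActivity_zero_gap, freePartition]

lemma tendsto_finitePerfectPressure (hβ : 0 < β) (hα : α < 0) :
    Tendsto (finitePerfectPressure ν β α) atTop (𝓝 (bulkPressure ν β α)) := by
  refine (tendsto_log_freePartition_activity hβ hα).congr fun L => ?_
  rw [finitePerfectPressure, finitePressure, partitionFunction_kinetic,
    tsum_exp_gibbsLevel_perfect]
  ring

lemma tendsto_finitePerfectDensity (hβ : 0 < β) (hα : α < 0) :
    Tendsto (finitePerfectDensity ν β α) atTop (𝓝 (bulkDensity ν β α)) := by
  refine (tendsto_meanNumber_activity hβ hα).congr' ?_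
  filter_upwards [eventually_gt_atTop 0] with L hL
  have h := subcritical_activity (ν := ν) hβ hL hα
  rw [finitePerfectDensity, gibbsExpectation, partitionFunction_kinetic,
    traceExp_eq (gibbsExponent_kinetic_ket L β α) totalNumber_ket, Complex.ofReal_re,
    tsum_exp_gibbsLevel_perfect]
  simp only [← weight_gapActivity, gapActivity_zero_gap]
  rw [h.tsum_degree_weight, mul_div_cancel_left₀ _ h.freePartition_pos.ne']

end Perfect

lemma summable_diagElement_totalNumber {β L α : ℝ} (hβ : 0 < β) (hL : 0 < L) (hα : α < 0) :
    Summable (diagElement (gibbsExponent (kinetic ν L 0) β α) (totalNumber ν)) := by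
  refine (Complex.ofRealCLM.summable
    ((subcritical_activity (ν := ν) hβ hL hα).summable_degree_pow 1)).congr fun n => ?_
  rw [diagElement_eq (gibbsExponent_kinetic_ket L β α) totalNumber_ket, ← weight_gapActivity,
    gapActivity_zero_gap, pow_one]
  rfl

end MeanField

end MeanFieldBose

end

open MeanFieldBose in
/-- The pressure of the mean-field Bose gas with gap. The first conjuncts say that all finite-volume
traces and all thermodynamic limits in the formula exist; the last two are the formula. -/
theorem theorem2 (ν : ℕ) (hν : 1 ≤ ν) (β Δ lam : ℝ) (hβ : 0 < β) (hΔ : 0 < Δ) (hlam : 0 < lam)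
    (μ : ℝ) :
    (∀ L : ℝ, 0 < L →
      IsTraceClassExp (gibbsExponent (meanFieldHamiltonian ν L Δ lam) β μ) ∧
      IsTraceClassExp (gibbsExponent (meanFieldHamiltonian ν L 0 lam) β μ) ∧
      IsTraceClassExp (gibbsExponent (kinetic ν L 0) β (-Δ)) ∧
      Summable (diagElement (gibbsExponent (kinetic ν L 0) β (-Δ)) (totalNumber ν))) ∧
    Tendsto (finitePerfectPressure ν β (-Δ)) atTop (𝓝 (perfectPressure ν β (-Δ))) ∧
    Tendsto (finitePerfectDensity ν β (-Δ)) atTop (𝓝 (perfectDensity ν β (-Δ))) ∧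
    Tendsto (finiteMeanFieldPressure ν Δ lam β μ) atTop (𝓝 (meanFieldPressure ν Δ lam β μ)) ∧
    Tendsto (finiteMeanFieldPressure ν 0 lam β μ) atTop (𝓝 (meanFieldPressure ν 0 lam β μ)) ∧
    (μ ≤ -Δ + lam * perfectDensity ν β (-Δ) →
      meanFieldPressure ν Δ lam β μ = meanFieldPressure ν 0 lam β μ) ∧
    (-Δ + lam * perfectDensity ν β (-Δ) < μ →
      meanFieldPressure ν Δ lam β μ =
        (μ + Δ) ^ 2 / (2 * lam) + perfectPressure ν β (-Δ)) := by
  have hΔ' : -Δ < 0 := neg_lt_zero.2 hΔ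
  have hdens : perfectDensity ν β (-Δ) = bulkDensity ν β (-Δ) :=
    (tendsto_finitePerfectDensity hβ hΔ').limUnder_eq
  have hpress : perfectPressure ν β (-Δ) = bulkPressure ν β (-Δ) :=
    (tendsto_finitePerfectPressure hβ hΔ').limUnder_eq
  rw [hdens, hpress]
  refine ⟨fun L hL => ⟨?_, ?_, ?_, summable_diagElement_totalNumber hβ hL hΔ'⟩,
    tendsto_finitePerfectPressure hβ hΔ', tendsto_finitePerfectDensity hβ hΔ',
    tendsto_nhds_limUnder (exists_tendsto_finiteMeanFieldPressure hν hβ hlam hΔ.le μ),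
    tendsto_nhds_limUnder (exists_tendsto_finiteMeanFieldPressure hν hβ hlam le_rfl μ),
    fun hμ => ?_, fun hμ => ?_⟩
  · exact isTraceClassExp_of_summable (gibbsExponent_meanField_ket L Δ lam β μ)
      (summable_exp_gibbsLevel hβ hlam hL hΔ.le μ)
  · exact isTraceClassExp_of_summable (gibbsExponent_meanField_ket L 0 lam β μ)
      (summable_exp_gibbsLevel hβ hlam hL le_rfl μ)
  · refine isTraceClassExp_of_summable (gibbsExponent_kinetic_ket L β (-Δ)) ?_
    simpa only [← weight_gapActivity, gapActivity_zero_gap] using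
      (subcritical_activity hβ hL hΔ').summable_weight
  · rcases exists_balance_or_deficit (ν := ν) hβ hlam hΔ.le μ with ⟨α, hα, h⟩ | h
    · exact (tendsto_of_balance hν hβ hlam hΔ.le hα h).limUnder_eq.trans
        (tendsto_of_balance hν hβ hlam le_rfl (by linarith) h).limUnder_eq.symm
    · -- a deficit below `-Δ` together with the hypothesis forces a balance at `-Δ` itself
      have hlim : Tendsto (fun α => lam * bulkDensity ν β α + α) (𝓝[<] (-Δ))
          (𝓝 (lam * bulkDensity ν β (-Δ) + -Δ)) :=
        tendsto_nhdsLT_of_continuousOn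
          (((continuousOn_bulkDensity hβ).const_mul lam).add continuousOn_id) hΔ
      have hle : lam * bulkDensity ν β (-Δ) + -Δ ≤ μ :=
        le_of_tendsto hlim (eventually_nhdsWithin_of_forall fun α hα => by
          linarith [h α hα])
      exact (tendsto_of_deficit hν hβ hlam hΔ h).limUnder_eq.trans
        (tendsto_of_balance hν hβ hlam le_rfl (by linarith) (by linarith)).limUnder_eq.symm
  · have h : ∀ α < -Δ, lam * bulkDensity ν β α ≤ μ - α := fun α hα => by
      have := mul_le_mul_of_nonneg_left (bulkDensity_mono (ν := ν) hβ hα.le hΔ') hlam.le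
      linarith
    rw [meanFieldPressure, (tendsto_of_deficit hν hβ hlam hΔ h).limUnder_eq, trialPressure,
      sub_neg_eq_add]
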